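/- Let $G_1$, $G_2$ and $\Lambda$ be locally compact Hausdorff groups and let $\varphi_i\colon\Lambda\to G_i$ ($i=1,2$) be homomorphisms which are homeomorphisms onto open subgroups of $G_i$ contained in the centre of $G_i$; that is, $\Lambda$ is a common open central subgroup of $G_1$ and $G_2$. Let $\Gamma=G_1*_\Lambda G_2$ be the amalgamated free product of groups with the finest group topology for which the canonical homomorphisms $G_1\to\Gamma$ and $G_2\to\Gamma$ are continuous. Then $\Gamma$ is a locally compact Hausdorff group and $G_1\to\Gamma$, $G_2\to\Gamma$ are homeomorphisms onto open subgroups. For a locally compact group $G$ with a left Haar measure, let $C^*(G)$ be its full group $C^*$-algebra, i.e. the completion of the convolution $*$-algebra $C_c(G)$ (equivalently $L^1(G)$) in the largest $C^*$-norm dominated by the $L^1$-norm. For any choice of Haar measures on $\Lambda,G_1,G_2,\Gamma$, extension of functions by zero (rescaled by a positive constant if the Haar measure on the subgroup is not the restriction of the one on the larger group) induces $*$-homomorphisms $j_i\colon C^*(\Lambda)\to C^*(G_i)$ and $\iota_i\colon C^*(G_i)\to C^*(\Gamma)$, and with these maps $$C^*(\Gamma)\cong C^*(G_1)*_{C^*(\Lambda)}C^*(G_2).$$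 That is: $j_1$ and $j_2$ are injective; $\iota_1\circ j_1=\iota_2\circ j_2$; the images of $\iota_1$ and $\iota_2$ generate the $C^*$-algebra $C^*(\Gamma)$; and for every (not necessarily unital) $C^*$-algebra $D$ and all $*$-homomorphisms $\psi_i\colon C^*(G_i)\to D$ with $\psi_1\circ j_1=\psi_2\circ j_2$ there is a unique $*$-homomorphism $\psi\colon C^*(\Gamma)\to D$ with $\psi\circ\iota_i=\psi_i$ for $i=1,2$. -/

import Mathlib

open MeasureTheory Topology
open scoped CompactlySupported

set_option linter.unusedSectionVars false

noncomputable section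

/-! ### The amalgamated free product of two topological groups -/

/-- The amalgamated free product `G₁ *_Λ G₂` of groups along two homomorphisms `φᵢ : Λ →* Gᵢ`:
the free product `G₁ * G₂` modulo the normal subgroup generated by the elements
`φ₁ l * (φ₂ l)⁻¹`. -/
def AmalgProd {Λ G₁ G₂ : Type*} [Group Λ] [Group G₁] [Group G₂]
    (φ₁ : Λ →* G₁) (φ₂ : Λ →* G₂) : Type _ :=
  Monoid.Coprod G₁ G₂ ⧸ Subgroup.normalClosure
    (Set.range fun l : Λ => Monoid.Coprod.inl (φ₁ l) * (Monoid.Coprod.inr (φ₂ l))⁻¹)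

namespace AmalgProd

section Algebra

variable {Λ G₁ G₂ : Type*} [Group Λ] [Group G₁] [Group G₂] (φ₁ : Λ →* G₁) (φ₂ : Λ →* G₂)

instance : Group (AmalgProd φ₁ φ₂) :=
  inferInstanceAs (Group (Monoid.Coprod G₁ G₂ ⧸ Subgroup.normalClosure _))

/-- The canonical homomorphism `G₁ → G₁ *_Λ G₂`. -/
def inl : G₁ →* AmalgProd φ₁ φ₂ :=
  (QuotientGroup.mk' _).comp Monoid.Coprod.inl

/-- The canonical homomorphism `G₂ → G₁ *_Λ G₂`. -/
def inr : G₂ →* AmalgProd φ₁ φ₂ :=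
  (QuotientGroup.mk' _).comp Monoid.Coprod.inr

end Algebra

section TopologyDefs

variable {Λ G₁ G₂ : Type*} [Group Λ] [Group G₁] [Group G₂] (φ₁ : Λ →* G₁) (φ₂ : Λ →* G₂)
  [TopologicalSpace G₁] [TopologicalSpace G₂]

/-- The topology of the amalgamated free product of topological groups: the finest group topology
for which the canonical homomorphisms from `G₁` and `G₂` are continuous. (In the order on group
topologies, finer topologies are smaller.) -/
def groupTopology : GroupTopology (AmalgProd φ₁ φ₂) :=
  sInf {t | Continuous[_, t.toTopologicalSpace] (inl φ₁ φ₂) ∧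
    Continuous[_, t.toTopologicalSpace] (inr φ₁ φ₂)}

instance : TopologicalSpace (AmalgProd φ₁ φ₂) := (groupTopology φ₁ φ₂).toTopologicalSpace

instance : IsTopologicalGroup (AmalgProd φ₁ φ₂) := (groupTopology φ₁ φ₂).toIsTopologicalGroup

end TopologyDefs

end AmalgProd

/-! ### The convolution *-algebra of compactly supported continuous functions -/

/-- The space `C_c(G)` of compactly supported continuous functions on a group `G` with left Haar
measure `μ`; it is a type of its own because it carries the convolution product
`(f * g)(x) = ∫ f(y) g(y⁻¹ x) dμ(y)` and the involution `f*(x) = Δ(x)⁻¹ conj (f(x⁻¹))`. -/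
def ConvAlg (G : Type*) [TopologicalSpace G] [MeasurableSpace G] (_μ : Measure G) : Type _ :=
  C_c(G, ℂ)

namespace ConvAlg

section Basic

variable {G : Type*} [TopologicalSpace G] [MeasurableSpace G] {μ : Measure G}

instance : AddCommGroup (ConvAlg G μ) := inferInstanceAs (AddCommGroup C_c(G, ℂ))
instance : Module ℂ (ConvAlg G μ) := inferInstanceAs (Module ℂ C_c(G, ℂ))
instance : FunLike (ConvAlg G μ) G ℂ := inferInstanceAs (FunLike C_c(G, ℂ) G ℂ)

theorem ext {f g : ConvAlg G μ} (h : ∀ x, f x = g x) : f = g := DFunLike.ext _ _ h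

theorem continuous_coe (f : ConvAlg G μ) : Continuous f :=
  (show C_c(G, ℂ) from f).continuous

theorem hasCompactSupport (f : ConvAlg G μ) : HasCompactSupport f :=
  CompactlySupportedContinuousMap.hasCompactSupport' f

@[simp] theorem add_apply (f g : ConvAlg G μ) (x : G) : (f + g) x = f x + g x := rfl
@[simp] theorem zero_apply (x : G) : (0 : ConvAlg G μ) x = 0 := rfl
@[simp] theorem smul_apply (c : ℂ) (f : ConvAlg G μ) (x : G) : (c • f) x = c * f x := rfl

end Basic

section Conv

variable {G : Type*} [TopologicalSpace G] [Group G] [IsTopologicalGroup G] [LocallyCompactSpace G]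
  [MeasurableSpace G] [BorelSpace G] {μ : Measure G} [μ.IsHaarMeasure]

open scoped Pointwise in
theorem conv_eq_zero (f g : ConvAlg G μ) {x y : G}
    (h : ¬ (y ∈ tsupport f ∧ x ∈ y • tsupport g)) : f y * g (y⁻¹ * x) = 0 := by
  by_contra h0
  refine h ⟨subset_tsupport _ (left_ne_zero_of_mul h0), ?_⟩
  exact ⟨y⁻¹ * x, subset_tsupport _ (right_ne_zero_of_mul h0), by simp⟩

theorem continuous_conv (f g : ConvAlg G μ) :
    Continuous fun x => ∫ y, f y * g (y⁻¹ * x) ∂μ := by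
  rw [← continuousOn_univ]
  refine continuousOn_integral_of_compact_support (f := fun x y => f y * g (y⁻¹ * x))
    (k := tsupport f) f.hasCompactSupport ?_ ?_
  · exact ((f.continuous_coe.comp continuous_snd).mul
      (g.continuous_coe.comp (continuous_snd.inv.mul continuous_fst))).continuousOn
  · intro x y _ hy
    exact conv_eq_zero f g fun h => hy h.1

open scoped Pointwise in
theorem hasCompactSupport_conv (f g : ConvAlg G μ) :
    HasCompactSupport fun x => ∫ y, f y * g (y⁻¹ * x) ∂μ := by
  refine HasCompactSupport.intro (K := tsupport f * tsupport g)
    (f.hasCompactSupport.mul g.hasCompactSupport) fun x hx => ?_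
  rw [← integral_zero G ℂ (μ := μ)]
  congr 1 with y
  refine conv_eq_zero f g fun h => hx ?_
  obtain ⟨z, hz, rfl⟩ := h.2
  exact ⟨y, h.1, z, hz, rfl⟩

instance : Mul (ConvAlg G μ) where
  mul f g := (⟨⟨fun x => ∫ y, f y * g (y⁻¹ * x) ∂μ, continuous_conv f g⟩,
    hasCompactSupport_conv f g⟩ : C_c(G, ℂ))

theorem mul_apply (f g : ConvAlg G μ) (x : G) : (f * g) x = ∫ y, f y * g (y⁻¹ * x) ∂μ := rfl

theorem integrable_conv (f g : ConvAlg G μ) (x : G) :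
    Integrable (fun y => f y * g (y⁻¹ * x)) μ := by
  refine Continuous.integrable_of_hasCompactSupport
    (f.continuous_coe.mul (g.continuous_coe.comp (by fun_prop))) ?_
  exact f.hasCompactSupport.mul_right

theorem conv_assoc (f g h : ConvAlg G μ) : f * g * h = f * (g * h) := by
  apply ext
  intro x
  have hswap : ∫ y, (∫ z, f z * g (z⁻¹ * y) * h (y⁻¹ * x) ∂μ) ∂μ
      = ∫ z, (∫ y, f z * g (z⁻¹ * y) * h (y⁻¹ * x) ∂μ) ∂μ := by
    have hf := f.continuous_coe
    have hg := g.continuous_coe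
    have hh := h.continuous_coe
    refine integral_integral_swap_of_hasCompactSupport
      (f := fun y z => f z * g (z⁻¹ * y) * h (y⁻¹ * x)) ?_ ?_
    · exact ((hf.comp continuous_snd).mul
        (hg.comp (continuous_snd.inv.mul continuous_fst))).mul
        (hh.comp (continuous_fst.inv.mul continuous_const))
    · open scoped Pointwise in
      refine HasCompactSupport.intro (K := (tsupport f * tsupport g) ×ˢ tsupport f)
        ((f.hasCompactSupport.mul g.hasCompactSupport).prod f.hasCompactSupport) ?_
      rintro ⟨y, z⟩ hyz
      have : f z * g (z⁻¹ * y) = 0 := by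
        refine conv_eq_zero f g fun hc => hyz ?_
        obtain ⟨w, hw, hwy⟩ := hc.2
        exact ⟨⟨z, hc.1, w, hw, hwy⟩, hc.1⟩
      simp [Function.uncurry, this]
  calc (f * g * h) x = ∫ y, (∫ z, f z * g (z⁻¹ * y) * h (y⁻¹ * x) ∂μ) ∂μ := by
        rw [mul_apply]
        congr 1 with y
        rw [mul_apply, integral_mul_const]
    _ = ∫ z, (∫ y, f z * g (z⁻¹ * y) * h (y⁻¹ * x) ∂μ) ∂μ := hswap
    _ = (f * (g * h)) x := by
        rw [mul_apply]
        congr 1 with z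
        rw [mul_apply, ← integral_const_mul,
          ← integral_mul_left_eq_self (fun y => f z * g (z⁻¹ * y) * h (y⁻¹ * x)) z]
        congr 1 with y
        simp [mul_assoc]

instance : NonUnitalRing (ConvAlg G μ) where
  left_distrib f g h := by
    apply ext; intro x
    simp only [mul_apply, add_apply, mul_add]
    exact integral_add (integrable_conv f g x) (integrable_conv f h x)
  right_distrib f g h := by
    apply ext; intro x
    simp only [mul_apply, add_apply, add_mul]
    exact integral_add (integrable_conv f h x) (integrable_conv g h x)
  zero_mul f := by apply ext; intro x; simp [mul_apply]
  mul_zero f := by apply ext; intro x; simp [mul_apply]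
  mul_assoc := conv_assoc

instance : IsScalarTower ℂ (ConvAlg G μ) (ConvAlg G μ) where
  smul_assoc c f g := by
    apply ext; intro x
    simp [smul_eq_mul, mul_apply, mul_assoc, integral_const_mul]

instance : SMulCommClass ℂ (ConvAlg G μ) (ConvAlg G μ) where
  smul_comm c f g := by
    apply ext; intro x
    simp [smul_eq_mul, mul_apply, mul_left_comm _ c, integral_const_mul]

theorem continuous_modularCharacter :
    Continuous fun x : G => ((Measure.modularCharacter x : NNReal) : ℝ) := by
  borelize G
  let ν : Measure G := Measure.haar
  obtain ⟨⟨u, u_cont⟩, u_comp, u_nonneg, u_one⟩ :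
    ∃ u : C(G, ℝ), HasCompactSupport u ∧ 0 ≤ u ∧ u 1 ≠ 0 := exists_continuous_nonneg_pos 1
  have hpos : ∫ x, u x ∂ν ≠ 0 :=
    ne_of_gt (u_cont.integral_pos_of_hasCompactSupport_nonneg_nonzero u_comp u_nonneg u_one)
  have key : ∀ g : G, ((Measure.modularCharacter g : NNReal) : ℝ)
      = (∫ x, u (x * g) ∂ν) / ∫ x, u x ∂ν := by
    intro g
    change ((Measure.modularCharacterFun g : NNReal) : ℝ) = _
    rw [Measure.modularCharacterFun_eq_haarScalarFactor ν g,
      Measure.haarScalarFactor_eq_integral_div _ _ u_cont u_comp hpos,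
      integral_map (AEMeasurable.mul_const aemeasurable_id' _)
        (Continuous.aestronglyMeasurable u_cont)]
  simp_rw [key]
  refine Continuous.div_const ?_ _
  refine continuous_iff_continuousAt.2 fun x₀ => ?_
  obtain ⟨t, t_comp, ht⟩ : ∃ t, IsCompact t ∧ t ∈ 𝓝 x₀ := exists_compact_mem_nhds x₀
  open scoped Pointwise in
  have A : ContinuousOn (fun g : G => ∫ x, u (x * g) ∂ν) t := by
    refine continuousOn_integral_of_compact_support (f := fun g x => u (x * g))
      (k := tsupport u * t⁻¹) (IsCompact.mul u_comp t_comp.inv) ?_ ?_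
    · exact (u_cont.comp (continuous_snd.mul continuous_fst)).continuousOn
    · intro g x hg hx
      by_contra h0
      exact hx ⟨x * g, subset_tsupport _ h0, g⁻¹, Set.inv_mem_inv.2 hg, by simp⟩
  exact A.continuousAt ht

/-- The involution `f*(x) = Δ(x)⁻¹ conj (f(x⁻¹))`, where `Δ` is the usual modular function,
`μ(E x) = Δ(x) μ(E)`. The modular character of Mathlib is normalised by
`μ(E x⁻¹) = modularCharacter x * μ(E)`, so that it is the function `Δ⁻¹`. -/
instance : Star (ConvAlg G μ) where
  star f := (⟨⟨fun x => (((Measure.modularCharacter x : NNReal) : ℝ) : ℂ) * star (f x⁻¹),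
    (Complex.continuous_ofReal.comp continuous_modularCharacter).mul
      (f.continuous_coe.comp continuous_inv).star⟩, by
    open scoped Pointwise in
    refine HasCompactSupport.intro (K := (tsupport f)⁻¹) (IsCompact.inv f.hasCompactSupport) ?_
    intro x hx
    have : f x⁻¹ = 0 := by
      by_contra h0
      exact hx (Set.mem_inv.2 (subset_tsupport _ h0))
    simp [this]⟩ : C_c(G, ℂ))

theorem star_apply (f : ConvAlg G μ) (x : G) :
    (star f) x = (((Measure.modularCharacter x : NNReal) : ℝ) : ℂ) * star (f x⁻¹) := rfl

instance : StarRing (ConvAlg G μ) where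
  star_involutive f := by
    apply ext; intro x
    have h : Measure.modularCharacter x * Measure.modularCharacter x⁻¹ = 1 := by
      rw [← map_mul]; simp
    have h' : (((Measure.modularCharacter x : NNReal) : ℝ) : ℂ) *
        (((Measure.modularCharacter x⁻¹ : NNReal) : ℝ) : ℂ) = 1 := by exact_mod_cast h
    simp only [star_apply, inv_inv, star_mul', star_star]
    rw [← mul_assoc, Complex.star_def, Complex.conj_ofReal, h', one_mul]
  star_mul f g := by
    apply ext; intro x
    rw [star_apply, mul_apply, mul_apply,
      ← integral_mul_left_eq_self (fun y => (star g) y * (star f) (y⁻¹ * x)) x,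
      Complex.star_def, ← integral_conj, ← integral_const_mul]
    congr 1 with y
    have h : Measure.modularCharacter (x * y) * Measure.modularCharacter (y⁻¹ * x⁻¹ * x)
        = Measure.modularCharacter x := by
      rw [← map_mul]; simp
    have h' : (((Measure.modularCharacter (x * y) : NNReal) : ℝ) : ℂ) *
        (((Measure.modularCharacter (y⁻¹ * x⁻¹ * x) : NNReal) : ℝ) : ℂ)
        = (((Measure.modularCharacter x : NNReal) : ℝ) : ℂ) := by exact_mod_cast h
    simp only [star_apply, mul_inv_rev, ← h', Complex.star_def, map_mul]
    simp
    ring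
  star_add f g := by
    apply ext; intro x
    simp [star_apply, mul_add]

instance : StarModule ℂ (ConvAlg G μ) where
  star_smul c f := by
    apply ext; intro x
    simp [star_apply]
    ring

/-! ### The maximal C*-seminorm -/

/-- A C*-seminorm on the convolution algebra which is dominated by the `L¹`-norm. -/
structure IsCStarSeminorm (p : Seminorm ℂ (ConvAlg G μ)) : Prop where
  mul_le : ∀ f g, p (f * g) ≤ p f * p g
  star_mul_self : ∀ f, p (star f * f) = p f ^ 2
  le_L1 : ∀ f, p f ≤ ∫ x, ‖f x‖ ∂μ

theorem IsCStarSeminorm.star_eq {p : Seminorm ℂ (ConvAlg G μ)} (hp : IsCStarSeminorm p)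
    (f : ConvAlg G μ) : p (star f) = p f := by
  have key : ∀ f : ConvAlg G μ, p f ≤ p (star f) := by
    intro f
    rcases (apply_nonneg p f).eq_or_lt with h | h
    · rw [← h]; exact apply_nonneg p _
    · have := hp.mul_le (star f) f
      rw [hp.star_mul_self, sq] at this
      exact le_of_mul_le_mul_right this h
  refine le_antisymm ?_ (key f)
  simpa using key (star f)

theorem isCStarSeminorm_zero : IsCStarSeminorm (0 : Seminorm ℂ (ConvAlg G μ)) where
  mul_le f g := by simp
  star_mul_self f := by simp
  le_L1 f := by
    simpa using integral_nonneg fun x => norm_nonneg (f x)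

instance : Nonempty {p : Seminorm ℂ (ConvAlg G μ) // IsCStarSeminorm p} :=
  ⟨⟨0, isCStarSeminorm_zero⟩⟩

/-- The norm of the full group C*-algebra: the supremum of all C*-seminorms dominated by the
`L¹`-norm, that is, of all `‖π(f)‖` over the *-representations `π` bounded by the `L¹`-norm. -/
def maxNorm (f : ConvAlg G μ) : ℝ :=
  ⨆ p : {p : Seminorm ℂ (ConvAlg G μ) // IsCStarSeminorm p}, p.1 f

theorem bddAbove_maxNorm (f : ConvAlg G μ) :
    BddAbove (Set.range fun p : {p : Seminorm ℂ (ConvAlg G μ) // IsCStarSeminorm p} => p.1 f) :=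
  ⟨∫ x, ‖f x‖ ∂μ, by rintro _ ⟨p, rfl⟩; exact p.2.le_L1 f⟩

theorem le_maxNorm {p : Seminorm ℂ (ConvAlg G μ)} (hp : IsCStarSeminorm p) (f : ConvAlg G μ) :
    p f ≤ maxNorm f :=
  le_ciSup (bddAbove_maxNorm f) ⟨p, hp⟩

theorem maxNorm_nonneg (f : ConvAlg G μ) : 0 ≤ maxNorm f :=
  (apply_nonneg _ f).trans (le_maxNorm isCStarSeminorm_zero f)

theorem maxNorm_le_L1 (f : ConvAlg G μ) : maxNorm f ≤ ∫ x, ‖f x‖ ∂μ :=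
  ciSup_le fun p => p.2.le_L1 f

/-- The largest C*-seminorm as a seminorm. -/
def maxSeminorm : Seminorm ℂ (ConvAlg G μ) :=
  Seminorm.ofSMulLE maxNorm
    (le_antisymm (ciSup_le fun p => by simp) (maxNorm_nonneg 0))
    (fun f g => ciSup_le fun p => (map_add_le_add p.1 f g).trans
      (add_le_add (le_maxNorm p.2 f) (le_maxNorm p.2 g)))
    (fun c f => ciSup_le fun p => by
      rw [map_smul_eq_mul]
      exact mul_le_mul_of_nonneg_left (le_maxNorm p.2 f) (norm_nonneg c))

theorem isCStarSeminorm_maxSeminorm : IsCStarSeminorm (maxSeminorm : Seminorm ℂ (ConvAlg G μ)) where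
  mul_le f g := ciSup_le fun p => (p.2.mul_le f g).trans
    (mul_le_mul (le_maxNorm p.2 f) (le_maxNorm p.2 g) (apply_nonneg _ _) (maxNorm_nonneg f))
  star_mul_self f := by
    refine le_antisymm (ciSup_le fun p => ?_) ?_
    · rw [p.2.star_mul_self]
      exact pow_le_pow_left₀ (apply_nonneg _ _) (le_maxNorm p.2 f) 2
    · have h : maxNorm f ≤ Real.sqrt (maxNorm (star f * f)) := ciSup_le fun p => by
        refine Real.le_sqrt_of_sq_le ?_
        rw [← p.2.star_mul_self]
        exact le_maxNorm p.2 _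
      exact (Real.le_sqrt (maxNorm_nonneg f) (maxNorm_nonneg _)).1 h
  le_L1 := maxNorm_le_L1

instance : NonUnitalSeminormedRing (ConvAlg G μ) where
  __ := (maxSeminorm : Seminorm ℂ (ConvAlg G μ)).toSeminormedAddCommGroup
  __ : NonUnitalRing (ConvAlg G μ) := inferInstance
  norm_mul_le := isCStarSeminorm_maxSeminorm.mul_le

theorem norm_eq_maxNorm (f : ConvAlg G μ) : ‖f‖ = maxNorm f := rfl

instance : NormedSpace ℂ (ConvAlg G μ) where
  norm_smul_le c f := (map_smul_eq_mul (maxSeminorm : Seminorm ℂ (ConvAlg G μ)) c f).le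

end Conv

end ConvAlg

/-! ### The full group C*-algebra -/

/-- The full group C*-algebra of a locally compact group `G` with left Haar measure `μ`: the
completion of the convolution algebra `C_c(G)` in its largest C*-norm. -/
def FullGroupCStar (G : Type*) [TopologicalSpace G] [Group G] [IsTopologicalGroup G]
    [LocallyCompactSpace G] [MeasurableSpace G] [BorelSpace G] (μ : Measure G)
    [μ.IsHaarMeasure] : Type _ :=
  UniformSpace.Completion (ConvAlg G μ)

namespace FullGroupCStar

open UniformSpace UniformSpace.Completion

variable {G : Type*} [TopologicalSpace G] [Group G] [IsTopologicalGroup G] [LocallyCompactSpace G]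
  [MeasurableSpace G] [BorelSpace G] {μ : Measure G} [μ.IsHaarMeasure]

instance : NormedAddCommGroup (FullGroupCStar G μ) :=
  inferInstanceAs (NormedAddCommGroup (Completion (ConvAlg G μ)))

instance : NormedSpace ℂ (FullGroupCStar G μ) :=
  inferInstanceAs (NormedSpace ℂ (Completion (ConvAlg G μ)))

instance : CompleteSpace (FullGroupCStar G μ) :=
  inferInstanceAs (CompleteSpace (Completion (ConvAlg G μ)))

/-- The canonical map `C_c(G) → C*(G)`. -/
def of (f : ConvAlg G μ) : FullGroupCStar G μ := ((f : Completion (ConvAlg G μ)) : Completion _)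

theorem isDenseInducing_of : IsDenseInducing (of : ConvAlg G μ → FullGroupCStar G μ) :=
  isDenseInducing_coe

theorem denseRange_of : DenseRange (of : ConvAlg G μ → FullGroupCStar G μ) :=
  isDenseInducing_of.dense

theorem continuous_of : Continuous (of : ConvAlg G μ → FullGroupCStar G μ) :=
  isDenseInducing_of.continuous

theorem norm_of (f : ConvAlg G μ) : ‖of f‖ = ‖f‖ := norm_coe f
theorem of_add (f g : ConvAlg G μ) : of (f + g) = of f + of g := coe_add f g
theorem of_zero : of (0 : ConvAlg G μ) = 0 := coe_zero
theorem of_smul (c : ℂ) (f : ConvAlg G μ) : of (c • f) = c • of f := coe_smul c f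

instance : Mul (FullGroupCStar G μ) where
  mul a b := (isDenseInducing_of.prodMap isDenseInducing_of).extend
    (fun q : ConvAlg G μ × ConvAlg G μ => of (q.1 * q.2)) (a, b)

theorem of_mul (f g : ConvAlg G μ) : of (f * g) = of f * of g :=
  ((isDenseInducing_of.prodMap isDenseInducing_of).extend_eq
    (f := fun q : ConvAlg G μ × ConvAlg G μ => of (q.1 * q.2))
    (continuous_of.comp continuous_mul) (f, g)).symm

instance : ContinuousMul (FullGroupCStar G μ) where
  continuous_mul := by
    let m : ConvAlg G μ →+ ConvAlg G μ →+ Completion (ConvAlg G μ) :=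
      (AddMonoidHom.mul : ConvAlg G μ →+ ConvAlg G μ →+ ConvAlg G μ).compr₂ toCompl
    have hm : Continuous fun p : ConvAlg G μ × ConvAlg G μ => m p.1 p.2 :=
      (Completion.continuous_coe (ConvAlg G μ)).comp continuous_mul
    have di : IsDenseInducing (toCompl : ConvAlg G μ → Completion (ConvAlg G μ)) :=
      isDenseInducing_coe
    exact (di.extend_Z_bilin di hm :)

instance : Star (FullGroupCStar G μ) where
  star a := isDenseInducing_of.extend (fun f : ConvAlg G μ => of (star f)) a

theorem norm_star_conv (f : ConvAlg G μ) : ‖star f‖ = ‖f‖ :=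
  ConvAlg.isCStarSeminorm_maxSeminorm.star_eq f

theorem continuous_star_conv : Continuous fun f : ConvAlg G μ => star f :=
  (AddMonoidHomClass.isometry_of_norm (starAddEquiv : ConvAlg G μ ≃+ ConvAlg G μ)
    norm_star_conv).continuous

theorem of_star (f : ConvAlg G μ) : of (star f) = star (of f) :=
  (isDenseInducing_of.extend_eq (f := fun f : ConvAlg G μ => of (star f))
    (continuous_of.comp continuous_star_conv) f).symm

instance : ContinuousStar (FullGroupCStar G μ) where
  continuous_star := by
    have h : UniformContinuous fun f : ConvAlg G μ => star f :=
      (AddMonoidHomClass.isometry_of_norm (starAddEquiv : ConvAlg G μ ≃+ ConvAlg G μ)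
        norm_star_conv).uniformContinuous
    exact uniformContinuous_uniformly_extend (Completion.isUniformInducing_coe _)
      Completion.denseRange_coe
      ((Completion.uniformContinuous_coe (ConvAlg G μ)).comp h) |>.continuous

theorem induction_on {P : FullGroupCStar G μ → Prop} (a : FullGroupCStar G μ)
    (hP : IsClosed {a | P a}) (h : ∀ f, P (of f)) : P a :=
  Completion.induction_on a hP h

theorem induction_on₂ {P : FullGroupCStar G μ → FullGroupCStar G μ → Prop}
    (a b : FullGroupCStar G μ)
    (hP : IsClosed {x : FullGroupCStar G μ × FullGroupCStar G μ | P x.1 x.2})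
    (h : ∀ f g, P (of f) (of g)) : P a b :=
  Completion.induction_on₂ a b hP h

theorem induction_on₃ {P : FullGroupCStar G μ → FullGroupCStar G μ → FullGroupCStar G μ → Prop}
    (a b c : FullGroupCStar G μ)
    (hP : IsClosed {x : FullGroupCStar G μ × FullGroupCStar G μ × FullGroupCStar G μ |
      P x.1 x.2.1 x.2.2})
    (h : ∀ f g k, P (of f) (of g) (of k)) : P a b c :=
  Completion.induction_on₃ a b c hP h

instance : NonUnitalRing (FullGroupCStar G μ) where
  zero_mul a := by
    induction a using induction_on with
    | hP => exact isClosed_eq (by fun_prop) (by fun_prop)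
    | h f => rw [← of_zero, ← of_mul, zero_mul]
  mul_zero a := by
    induction a using induction_on with
    | hP => exact isClosed_eq (by fun_prop) (by fun_prop)
    | h f => rw [← of_zero, ← of_mul, mul_zero]
  mul_assoc a b c := by
    induction a, b, c using induction_on₃ with
    | hP => exact isClosed_eq (by fun_prop) (by fun_prop)
    | h f g k => simp only [← of_mul, mul_assoc]
  left_distrib a b c := by
    induction a, b, c using induction_on₃ with
    | hP => exact isClosed_eq (by fun_prop) (by fun_prop)
    | h f g k => simp only [← of_mul, ← of_add, mul_add]
  right_distrib a b c := by
    induction a, b, c using induction_on₃ with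
    | hP => exact isClosed_eq (by fun_prop) (by fun_prop)
    | h f g k => simp only [← of_mul, ← of_add, add_mul]

instance : StarRing (FullGroupCStar G μ) where
  star_involutive a := by
    induction a using induction_on with
    | hP => exact isClosed_eq (by fun_prop) (by fun_prop)
    | h f => simp only [← of_star, star_star]
  star_mul a b := by
    induction a, b using induction_on₂ with
    | hP => exact isClosed_eq (by fun_prop) (by fun_prop)
    | h f g => simp only [← of_star, ← of_mul, star_mul]
  star_add a b := by
    induction a, b using induction_on₂ with
    | hP => exact isClosed_eq (by fun_prop) (by fun_prop)
    | h f g => simp only [← of_star, ← of_add, star_add]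

theorem smul_mul_aux (c : ℂ) (a b : FullGroupCStar G μ) : c • a * b = c • (a * b) := by
  induction a, b using induction_on₂ with
  | hP =>
    exact isClosed_eq ((continuous_fst.const_smul c).mul continuous_snd)
      ((continuous_fst.mul continuous_snd).const_smul c)
  | h f g => rw [← of_smul, ← of_mul, ← of_mul, ← of_smul, smul_mul_assoc]

theorem mul_smul_aux (c : ℂ) (a b : FullGroupCStar G μ) : a * c • b = c • (a * b) := by
  induction a, b using induction_on₂ with
  | hP =>
    exact isClosed_eq (continuous_fst.mul (continuous_snd.const_smul c))
      ((continuous_fst.mul continuous_snd).const_smul c)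
  | h f g => rw [← of_smul, ← of_mul, ← of_mul, ← of_smul, mul_smul_comm]

theorem star_smul_aux (c : ℂ) (a : FullGroupCStar G μ) : star (c • a) = star c • star a := by
  induction a using induction_on with
  | hP =>
    have h₁ : Continuous fun a : FullGroupCStar G μ => star (c • a) :=
      (continuous_id.const_smul c).star
    have h₂ : Continuous fun a : FullGroupCStar G μ => star c • star a :=
      Continuous.const_smul (continuous_id.star) (star c)
    exact isClosed_eq h₁ h₂
  | h f => rw [← of_star, ← of_smul, ← of_smul, ← of_star, star_smul]

theorem norm_mul_aux (a b : FullGroupCStar G μ) : ‖a * b‖ ≤ ‖a‖ * ‖b‖ := by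
  induction a, b using induction_on₂ with
  | hP => exact isClosed_le (by fun_prop) (by fun_prop)
  | h f g =>
    rw [← of_mul, norm_of, norm_of, norm_of]
    exact norm_mul_le f g

theorem norm_mul_self_aux (a : FullGroupCStar G μ) : ‖a‖ * ‖a‖ ≤ ‖star a * a‖ := by
  induction a using induction_on with
  | hP => exact isClosed_le (by fun_prop) (by fun_prop)
  | h f =>
    rw [← of_star, ← of_mul, norm_of, norm_of, ← sq]
    exact (ConvAlg.isCStarSeminorm_maxSeminorm.star_mul_self f).ge

instance : NonUnitalNormedRing (FullGroupCStar G μ) where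
  __ : NormedAddCommGroup (FullGroupCStar G μ) := inferInstance
  __ : NonUnitalRing (FullGroupCStar G μ) := inferInstance
  norm_mul_le := norm_mul_aux

instance : NonUnitalCStarAlgebra (FullGroupCStar G μ) where
  __ : NonUnitalNormedRing (FullGroupCStar G μ) := inferInstance
  __ : StarRing (FullGroupCStar G μ) := inferInstance
  __ : NormedSpace ℂ (FullGroupCStar G μ) := inferInstance
  __ : CompleteSpace (FullGroupCStar G μ) := inferInstance
  norm_mul_self_le := norm_mul_self_aux
  smul_assoc := smul_mul_aux
  smul_comm c a b := (mul_smul_aux c a b).symm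
  star_smul := star_smul_aux

end FullGroupCStar

/-! ### Maps induced by open embeddings of groups, and amalgamated free products -/

/-- `Φ : C*(H) → C*(G)` is the *-homomorphism induced by the embedding `φ : H → G` of `H` as an
open subgroup of `G`: it sends `f ∈ C_c(H)` to `c` times its extension by zero along `φ`, where `c`
compares the two chosen Haar measures, `μ_H = c · μ_G` on the subgroup. (So `f μ_H`, as a measure
on `G`, is the image times `μ_G`; and `c = 1` if `μ_H` is the restriction of `μ_G`.) -/
def IsInducedHom {H G : Type*}
    [TopologicalSpace H] [Group H] [IsTopologicalGroup H] [LocallyCompactSpace H]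
    [MeasurableSpace H] [BorelSpace H]
    [TopologicalSpace G] [Group G] [IsTopologicalGroup G] [LocallyCompactSpace G]
    [MeasurableSpace G] [BorelSpace G]
    (φ : H →* G) (μH : Measure H) [μH.IsHaarMeasure] (μG : Measure G) [μG.IsHaarMeasure]
    (Φ : FullGroupCStar H μH →⋆ₙₐ[ℂ] FullGroupCStar G μG) : Prop :=
  ∃ c : ℝ, 0 < c ∧
    (∀ k : C_c(G, ℂ), ∫ y, k (φ y) ∂μH = c * ∫ x in Set.range φ, k x ∂μG) ∧
    ∀ f : ConvAlg H μH, ∃ F : ConvAlg G μG,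
      (∀ x, F x = c * Function.extend φ f 0 x) ∧ Φ (FullGroupCStar.of f) = FullGroupCStar.of F

/-- `P`, with the *-homomorphisms `ι₁ : A → P` and `ι₂ : B → P`, is the amalgamated free product
`A *_C B` of the C*-algebras `A` and `B`, each containing a copy of `C` by `j₁` and `j₂`: the maps
agree on `C`, their images generate `P`, and any pair of *-homomorphisms from `A` and `B` into
another C*-algebra that agree on `C` factors through `ι₁` and `ι₂`. C*-algebras and their
*-homomorphisms need not be unital. -/
structure IsAmalgFreeProduct.{w, a, b, c, d} {C : Type c} {A : Type a} {B : Type b} {P : Type d}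
    [NonUnitalCStarAlgebra C] [NonUnitalCStarAlgebra A] [NonUnitalCStarAlgebra B]
    [NonUnitalCStarAlgebra P]
    (j₁ : C →⋆ₙₐ[ℂ] A) (j₂ : C →⋆ₙₐ[ℂ] B) (ι₁ : A →⋆ₙₐ[ℂ] P) (ι₂ : B →⋆ₙₐ[ℂ] P) : Prop where
  injective_left : Function.Injective j₁
  injective_right : Function.Injective j₂
  comm : ι₁.comp j₁ = ι₂.comp j₂
  generates : Dense (NonUnitalStarAlgebra.adjoin ℂ (Set.range ι₁ ∪ Set.range ι₂) : Set P)
  lift : ∀ (D : Type w) [NonUnitalCStarAlgebra D] (ψ₁ : A →⋆ₙₐ[ℂ] D) (ψ₂ : B →⋆ₙₐ[ℂ] D),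
    ψ₁.comp j₁ = ψ₂.comp j₂ → ∃! ψ : P →⋆ₙₐ[ℂ] D, ψ.comp ι₁ = ψ₁ ∧ ψ.comp ι₂ = ψ₂

end

universe u₀ u₁ u₂ w

/-!
Write `Γ = AmalgProd φ₁ φ₂` and `j : Λ → Γ` for the common homomorphism through either factor.

**The topology.** The image of `Λ` in `Γ` is central, so the images of the neighbourhoods of the
identity of `Λ` form a group filter basis (`centralFilterBasis`); in the resulting group topology
both canonical maps are continuous, because they are so on the open image of `Λ`. The topology of
`Γ` is the finest with this property, hence `j` and both canonical maps are open for it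
(`AmalgProd.nhds_one_le`). They are injective because the maps of `G₁` and `G₂` to the central
product `(G₁ × G₂) / Λ` are (`AmalgProd.injective_inl_inr`). A group with an open subgroup that is
Hausdorff or locally compact has the same property. Moreover a group with an open central subgroup
is unimodular (`modularCharacter_eq_one_of_central`), so that no modular function appears below.

**Functions on cosets.** Let `H` be open and central in `G`. Every function in `C_c(G)` is a finite
sum of functions `δ_g * f`, with `f ∈ C_c(H)` extended by zero
(`ConvAlg.induction_translate_extend`), and centrality gives
`(δ_g * a) * (δ_h * b) = δ_{gh} * (a * b)` and `(δ_g * a)* = δ_{g⁻¹} * a*`. A *-homomorphism on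
`C_c(G)` is therefore the same as a family of linear maps on `C_c(H)` indexed by `G` with these
rules and compatible with right translation by `H` (`ConvAlg.cosetHom`); it extends to `C*(G)` as
soon as it is bounded by the `L¹`-norm (`FullGroupCStar.lift`), which can be checked on each coset.

**Injectivity of `C*(H) → C*(G)`.** The restriction of `X* * Y` to `H` is a `C*(H)`-valued inner
product on `C_c(G)`, the orthogonal sum of the standard ones on the cosets
(`ConvAlg.innerProd_eq_sum`). The operator norm of left multiplication for the associated seminorm
is a C*-seminorm bounded by the `L¹`-norm, hence at most the maximal one
(`ConvAlg.mul_le_norm_mul`), and on `C_c(H)` it is at least the norm of `C*(H)`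
(`ConvAlg.norm_le_norm_extend`).

**The universal property.** Given `ψ₁` and `ψ₂` that agree on `C*(Λ)`, with common restriction `ψ₀`,
let `E` be the closed right ideal of `D` generated by the image of `ψ₀`. Each `Gᵢ` acts on `E` by
`g (ψ₀(f) d) = ψᵢ(δ_g * f) d` (`FullGroupCStar.actionHom`); this replaces the unitaries that `ψᵢ`
would give in the multipliers of a nondegenerate image. The two actions agree on `Λ`, so the
universal property of the group `Γ` gives an action `U` of `Γ` on `E`. It is unitary for the
`D`-valued inner product `x* y` and commutes with right multiplication by `D` and with `ψ₀`
(`FullGroupCStar.IsCovariant`), as this holds on the generators. The family `f ↦ U γ (ψ₀ f)` obeys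
the rules above and so defines the *-homomorphism `C*(Γ) → D`
(`FullGroupCStar.exists_integratedForm`). Adjointness of `U γ` and `U γ⁻¹` gives the rule for the
star only after multiplication by elements of `E`; that `E` contains the elements `(U γ (ψ₀ f))*`
follows with an approximate unit.

**Generation and uniqueness.** By an approximate unit of `C*(Λ)`, the `γ` for which a closed
subalgebra contains all `δ_γ * f`, `f ∈ C_c(Λ)`, are closed under multiplication
(`FullGroupCStar.of_translate_mul_mem`). As the two factors generate `Γ`, a closed subalgebra
containing the images of `C*(G₁)` and `C*(G₂)` is everything.
-/

/-! ### Amalgamated free products over a central subgroup -/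

namespace AmalgProd

section Algebra

variable {Λ G₁ G₂ : Type*} [Group Λ] [Group G₁] [Group G₂] {φ₁ : Λ →* G₁} {φ₂ : Λ →* G₂}

theorem inl_comp_eq (φ₁ : Λ →* G₁) (φ₂ : Λ →* G₂) :
    (inl φ₁ φ₂).comp φ₁ = (inr φ₁ φ₂).comp φ₂ := by
  ext l
  refine mul_inv_eq_one.1 ?_
  exact (QuotientGroup.eq_one_iff (N := Subgroup.normalClosure
    (Set.range fun l : Λ => Monoid.Coprod.inl (φ₁ l) * (Monoid.Coprod.inr (φ₂ l))⁻¹)) _).2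
    (Subgroup.subset_normalClosure ⟨l, rfl⟩)

theorem inl_apply_eq (l : Λ) : inl φ₁ φ₂ (φ₁ l) = inr φ₁ φ₂ (φ₂ l) :=
  DFunLike.congr_fun (inl_comp_eq φ₁ φ₂) l

/-- The homomorphism out of the amalgamated free product given by homomorphisms on the factors
that agree on `Λ`. -/
def lift {H : Type*} [Group H] (f₁ : G₁ →* H) (f₂ : G₂ →* H) (h : f₁.comp φ₁ = f₂.comp φ₂) :
    AmalgProd φ₁ φ₂ →* H :=
  QuotientGroup.lift _ (Monoid.Coprod.lift f₁ f₂) (by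
    refine Subgroup.normalClosure_le_normal (N := (Monoid.Coprod.lift f₁ f₂).ker) ?_
    rintro _ ⟨l, rfl⟩
    have := DFunLike.congr_fun h l
    simp only [MonoidHom.comp_apply] at this
    simp [MonoidHom.mem_ker, this])

@[simp] theorem lift_inl {H : Type*} [Group H] (f₁ : G₁ →* H) (f₂ : G₂ →* H)
    (h : f₁.comp φ₁ = f₂.comp φ₂) (g : G₁) : lift f₁ f₂ h (inl φ₁ φ₂ g) = f₁ g :=
  Monoid.Coprod.lift_apply_inl f₁ f₂ g

@[simp] theorem lift_inr {H : Type*} [Group H] (f₁ : G₁ →* H) (f₂ : G₂ →* H)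
    (h : f₁.comp φ₁ = f₂.comp φ₂) (g : G₂) : lift f₁ f₂ h (inr φ₁ φ₂ g) = f₂ g :=
  Monoid.Coprod.lift_apply_inr f₁ f₂ g

@[elab_as_elim]
theorem induction {P : AmalgProd φ₁ φ₂ → Prop} (x : AmalgProd φ₁ φ₂)
    (hl : ∀ g, P (inl φ₁ φ₂ g)) (hr : ∀ g, P (inr φ₁ φ₂ g))
    (hmul : ∀ x y, P x → P y → P (x * y)) : P x := by
  obtain ⟨x, rfl⟩ := QuotientGroup.mk'_surjective _ x
  induction x using Monoid.Coprod.induction_on with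
  | inl g => exact hl g
  | inr g => exact hr g
  | mul x y hx hy => rw [map_mul]; exact hmul _ _ hx hy

/-- The kernel of the map from the direct product onto the central product: the pairs
`(φ₁ l, φ₂ l⁻¹)`. -/
def antidiagonal (φ₁ : Λ →* G₁) (φ₂ : Λ →* G₂) (hc₁ : φ₁.range ≤ Subgroup.center G₁) :
    Subgroup (G₁ × G₂) where
  carrier := {p | ∃ l, p = (φ₁ l, φ₂ l⁻¹)}
  one_mem' := ⟨1, by ext <;> simp⟩
  mul_mem' := by
    rintro _ _ ⟨l, rfl⟩ ⟨m, rfl⟩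
    refine ⟨m * l, ?_⟩
    have h₁ : φ₁ l * φ₁ m = φ₁ m * φ₁ l :=
      (Subgroup.mem_center_iff.1 (hc₁ ⟨m, rfl⟩) (φ₁ l))
    ext
    · simp [h₁]
    · simp
  inv_mem' := by
    rintro _ ⟨l, rfl⟩
    exact ⟨l⁻¹, by ext <;> simp⟩

theorem antidiagonal_normal (hc₁ : φ₁.range ≤ Subgroup.center G₁)
    (hc₂ : φ₂.range ≤ Subgroup.center G₂) : (antidiagonal φ₁ φ₂ hc₁).Normal where
  conj_mem := by
    rintro _ ⟨l, rfl⟩ ⟨a, b⟩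
    refine ⟨l, ?_⟩
    have h₁ := Subgroup.mem_center_iff.1 (hc₁ ⟨l, rfl⟩) a
    have h₂ := Subgroup.mem_center_iff.1 (hc₂ ⟨l⁻¹, rfl⟩) b
    ext
    · simp [h₁]
    · simp only [Prod.snd_mul, Prod.snd_inv, h₂, mul_inv_cancel_right]

/-- Both canonical maps are injective because they are so after mapping to the central product
`(G₁ × G₂) / {(φ₁ l, φ₂ l⁻¹)}`. -/
theorem injective_inl_inr (hφ₁ : Function.Injective φ₁) (hφ₂ : Function.Injective φ₂)
    (hc₁ : φ₁.range ≤ Subgroup.center G₁) (hc₂ : φ₂.range ≤ Subgroup.center G₂) :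
    Function.Injective (inl φ₁ φ₂) ∧ Function.Injective (inr φ₁ φ₂) := by
  have := antidiagonal_normal hc₁ hc₂
  let q := QuotientGroup.mk' (antidiagonal φ₁ φ₂ hc₁)
  let f₁ := q.comp (MonoidHom.inl G₁ G₂)
  let f₂ := q.comp (MonoidHom.inr G₁ G₂)
  have h : f₁.comp φ₁ = f₂.comp φ₂ := by
    ext l
    refine (QuotientGroup.eq (s := antidiagonal φ₁ φ₂ hc₁)).2 ⟨l⁻¹, ?_⟩
    ext <;> simp
  constructor
  · refine (injective_iff_map_eq_one _).2 fun g hg => ?_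
    have h1 : f₁ g = 1 := by rw [← lift_inl f₁ f₂ h, hg, map_one]
    obtain ⟨l, hl⟩ := (QuotientGroup.eq_one_iff (N := antidiagonal φ₁ φ₂ hc₁) _).1 h1
    have h2 : (1 : G₂) = φ₂ l⁻¹ := congrArg Prod.snd hl
    have h3 : l⁻¹ = 1 := hφ₂ (by rw [← h2, map_one])
    have h4 : g = φ₁ l := congrArg Prod.fst hl
    rw [h4, inv_eq_one.1 h3, map_one]
  · refine (injective_iff_map_eq_one _).2 fun g hg => ?_
    have h1 : f₂ g = 1 := by rw [← lift_inr f₁ f₂ h, hg, map_one]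
    obtain ⟨l, hl⟩ := (QuotientGroup.eq_one_iff (N := antidiagonal φ₁ φ₂ hc₁) _).1 h1
    have h2 : (1 : G₁) = φ₁ l := congrArg Prod.fst hl
    have h3 : l = 1 := hφ₁ (by rw [← h2, map_one])
    have h4 : g = φ₂ l⁻¹ := congrArg Prod.snd hl
    rw [h4, h3, inv_one, map_one]

theorem range_le_center (hc₁ : φ₁.range ≤ Subgroup.center G₁)
    (hc₂ : φ₂.range ≤ Subgroup.center G₂) :
    ((inl φ₁ φ₂).comp φ₁).range ≤ Subgroup.center (AmalgProd φ₁ φ₂) := by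
  rintro _ ⟨l, rfl⟩
  refine Subgroup.mem_center_iff.2 fun x => ?_
  induction x using induction with
  | hl g =>
    rw [MonoidHom.comp_apply, ← map_mul, ← map_mul,
      Subgroup.mem_center_iff.1 (hc₁ ⟨l, rfl⟩) g]
  | hr g =>
    rw [MonoidHom.comp_apply, inl_apply_eq, ← map_mul, ← map_mul,
      Subgroup.mem_center_iff.1 (hc₂ ⟨l, rfl⟩) g]
  | hmul x y hx hy => rw [mul_assoc, hy, ← mul_assoc, hx, mul_assoc]

end Algebra

end AmalgProd

section GroupTopology

open scoped Pointwise

/-- A central homomorphism `j` from a topological group transports the neighbourhoods of the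
identity to a group filter basis; in the resulting group topology `j` is an open map. -/
@[reducible] def centralFilterBasis {Λ Γ : Type*} [Group Λ] [TopologicalSpace Λ]
    [IsTopologicalGroup Λ] [Group Γ] (j : Λ →* Γ) (hj : j.range ≤ Subgroup.center Γ) :
    GroupFilterBasis Γ where
  sets := {V | ∃ U ∈ 𝓝 (1 : Λ), V = j '' U}
  nonempty := ⟨_, Set.univ, Filter.univ_mem, rfl⟩
  inter_sets := by
    rintro _ _ ⟨U, hU, rfl⟩ ⟨V, hV, rfl⟩
    exact ⟨_, ⟨U ∩ V, Filter.inter_mem hU hV, rfl⟩, Set.image_inter_subset j U V⟩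
  one' := by
    rintro _ ⟨U, hU, rfl⟩
    exact ⟨1, mem_of_mem_nhds hU, map_one j⟩
  mul' := by
    rintro _ ⟨U, hU, rfl⟩
    obtain ⟨V, hV, hVU⟩ := exists_nhds_one_split hU
    refine ⟨_, ⟨V, hV, rfl⟩, ?_⟩
    rintro _ ⟨_, ⟨v, hv, rfl⟩, _, ⟨w, hw, rfl⟩, rfl⟩
    exact ⟨v * w, hVU v hv w hw, map_mul j v w⟩
  inv' := by
    rintro _ ⟨U, hU, rfl⟩
    refine ⟨_, ⟨U⁻¹, inv_mem_nhds_one Λ hU, rfl⟩, ?_⟩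
    rintro _ ⟨x, hx, rfl⟩
    exact ⟨x⁻¹, hx, map_inv j x⟩
  conj' := by
    rintro x _ ⟨U, hU, rfl⟩
    refine ⟨_, ⟨U, hU, rfl⟩, ?_⟩
    rintro _ ⟨l, hl, rfl⟩
    refine ⟨l, hl, ?_⟩
    change j l = x * j l * x⁻¹
    rw [Subgroup.mem_center_iff.1 (hj ⟨l, rfl⟩) x, mul_inv_cancel_right]

theorem nhds_one_centralFilterBasis {Λ Γ : Type*} [Group Λ] [TopologicalSpace Λ]
    [IsTopologicalGroup Λ] [Group Γ] (j : Λ →* Γ) (hj : j.range ≤ Subgroup.center Γ) :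
    @nhds Γ (centralFilterBasis j hj).topology 1 = Filter.map j (𝓝 1) := by
  ext s
  rw [(centralFilterBasis j hj).nhds_one_hasBasis.mem_iff]
  constructor
  · rintro ⟨_, ⟨U, hU, rfl⟩, hs⟩
    exact Filter.mem_map.2 (Filter.mem_of_superset hU (Set.image_subset_iff.1 hs))
  · intro hs
    exact ⟨_, ⟨_, hs, rfl⟩, Set.image_preimage_subset j s⟩

end GroupTopology

theorem MonoidHom.isOpenMap_of_map_nhds_one {H G : Type*} [Group H] [TopologicalSpace H]
    [IsTopologicalGroup H] [Group G] [TopologicalSpace G] [IsTopologicalGroup G] (f : H →* G)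
    (h : 𝓝 (1 : G) ≤ Filter.map f (𝓝 1)) : IsOpenMap f := by
  refine IsOpenMap.of_nhds_le fun x => ?_
  rw [← map_mul_left_nhds_one x, ← map_mul_left_nhds_one (f x), Filter.map_map]
  have : f ∘ (fun y => x * y) = (fun y => f x * y) ∘ f := by ext; simp
  rw [this, ← Filter.map_map]
  exact Filter.map_mono h

namespace AmalgProd

section Topology

variable {Λ G₁ G₂ : Type*} [Group Λ] [Group G₁] [Group G₂] {φ₁ : Λ →* G₁} {φ₂ : Λ →* G₂}
  [TopologicalSpace Λ] [IsTopologicalGroup Λ]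
  [TopologicalSpace G₁] [IsTopologicalGroup G₁] [TopologicalSpace G₂] [IsTopologicalGroup G₂]

theorem continuous_inl : Continuous (inl φ₁ φ₂) := by
  refine continuous_sInf_rng.2 ?_
  rintro _ ⟨t, ht, rfl⟩
  exact ht.1

theorem continuous_inr : Continuous (inr φ₁ φ₂) := by
  refine continuous_sInf_rng.2 ?_
  rintro _ ⟨t, ht, rfl⟩
  exact ht.2

/-- The topology of the amalgamated free product is at least as fine as the group topology in
which the image of `Λ` is open, because in the latter both canonical maps are continuous. -/
theorem nhds_one_le (hφ₁ : IsOpenEmbedding φ₁) (hφ₂ : IsOpenEmbedding φ₂)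
    (hc₁ : φ₁.range ≤ Subgroup.center G₁) (hc₂ : φ₂.range ≤ Subgroup.center G₂) :
    𝓝 (1 : AmalgProd φ₁ φ₂) ≤ Filter.map ((inl φ₁ φ₂).comp φ₁) (𝓝 1) := by
  set j := (inl φ₁ φ₂).comp φ₁ with hj
  let B := centralFilterBasis j (range_le_center hc₁ hc₂)
  let t : GroupTopology (AmalgProd φ₁ φ₂) :=
    { toTopologicalSpace := B.topology, toIsTopologicalGroup := B.isTopologicalGroup }
  have h1 : @nhds _ t.toTopologicalSpace (1 : AmalgProd φ₁ φ₂) = Filter.map j (𝓝 1) :=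
    nhds_one_centralFilterBasis j _
  have hl : Continuous[_, t.toTopologicalSpace] (inl φ₁ φ₂) := by
    let _ := t.toTopologicalSpace
    have := t.toIsTopologicalGroup
    refine continuous_of_continuousAt_one (inl φ₁ φ₂) ?_
    rw [ContinuousAt, map_one, h1, ← map_one φ₁, ← hφ₁.map_nhds_eq, hj, MonoidHom.coe_comp,
      ← Filter.map_map]
    exact le_rfl
  have hr : Continuous[_, t.toTopologicalSpace] (inr φ₁ φ₂) := by
    let _ := t.toTopologicalSpace
    have := t.toIsTopologicalGroup
    refine continuous_of_continuousAt_one (inr φ₁ φ₂) ?_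
    rw [ContinuousAt, map_one, h1, ← map_one φ₂, ← hφ₂.map_nhds_eq, hj, inl_comp_eq,
      MonoidHom.coe_comp, ← Filter.map_map]
    exact le_rfl
  rw [← h1]
  exact nhds_mono (sInf_le (Set.mem_image_of_mem _ (show t ∈ {t | _} from ⟨hl, hr⟩)))

theorem isOpenEmbedding_inl (hφ₁ : IsOpenEmbedding φ₁) (hφ₂ : IsOpenEmbedding φ₂)
    (hc₁ : φ₁.range ≤ Subgroup.center G₁) (hc₂ : φ₂.range ≤ Subgroup.center G₂) :
    IsOpenEmbedding (inl φ₁ φ₂) := by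
  refine .of_continuous_injective_isOpenMap continuous_inl
    (injective_inl_inr hφ₁.injective hφ₂.injective hc₁ hc₂).1
    (MonoidHom.isOpenMap_of_map_nhds_one _ ?_)
  rw [← map_one φ₁, ← hφ₁.map_nhds_eq, Filter.map_map]
  exact nhds_one_le hφ₁ hφ₂ hc₁ hc₂

theorem isOpenEmbedding_inr (hφ₁ : IsOpenEmbedding φ₁) (hφ₂ : IsOpenEmbedding φ₂)
    (hc₁ : φ₁.range ≤ Subgroup.center G₁) (hc₂ : φ₂.range ≤ Subgroup.center G₂) :
    IsOpenEmbedding (inr φ₁ φ₂) := by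
  refine .of_continuous_injective_isOpenMap continuous_inr
    (injective_inl_inr hφ₁.injective hφ₂.injective hc₁ hc₂).2
    (MonoidHom.isOpenMap_of_map_nhds_one _ ?_)
  have h := nhds_one_le hφ₁ hφ₂ hc₁ hc₂
  rw [inl_comp_eq] at h
  rw [← map_one φ₂, ← hφ₂.map_nhds_eq, Filter.map_map]
  exact h

end Topology

end AmalgProd

section OpenSubgroup

variable {H G : Type*} [Group H] [TopologicalSpace H] [IsTopologicalGroup H]
  [Group G] [TopologicalSpace G] [IsTopologicalGroup G] {φ : H →* G}

theorem MonoidHom.isClosedEmbedding_of_isOpenEmbedding (hφ : IsOpenEmbedding φ) :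
    IsClosedEmbedding φ :=
  ⟨hφ.isEmbedding, Subgroup.isClosed_of_isOpen φ.range hφ.isOpen_range⟩

theorem MonoidHom.t2Space_of_isOpenEmbedding [T2Space H] (hφ : IsOpenEmbedding φ) :
    T2Space G := by
  refine IsTopologicalGroup.t2Space_iff_one_closed.2 ?_
  have := (isClosedEmbedding_of_isOpenEmbedding hφ).isClosedMap {1} isClosed_singleton
  simpa using this

theorem MonoidHom.locallyCompactSpace_of_isOpenEmbedding [LocallyCompactSpace H]
    (hφ : IsOpenEmbedding φ) : LocallyCompactSpace G := by
  obtain ⟨K, hK, hK1⟩ := exists_compact_mem_nhds (1 : H)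
  refine IsCompact.locallyCompactSpace_of_mem_nhds_of_group (hK.image hφ.continuous) (x := 1) ?_
  rw [← map_one φ]
  exact hφ.image_mem_nhds.2 hK1

end OpenSubgroup

/-! ### Integration over an open subgroup -/

section Integration

open Measure

variable {H G : Type*}
  [TopologicalSpace H] [Group H] [IsTopologicalGroup H]
  [MeasurableSpace H] [BorelSpace H]
  [TopologicalSpace G] [Group G] [IsTopologicalGroup G]
  [MeasurableSpace G] [BorelSpace G] {φ : H →* G}

theorem isHaarMeasure_comap (μG : Measure G) [μG.IsHaarMeasure] (hφ : IsOpenEmbedding φ) :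
    (μG.comap φ).IsHaarMeasure :=
  IsHaarMeasure.comap (mH := ContinuousMul.measurableMul) μG hφ

/-- The constant `c` with `μH = c · μG` on the open subgroup `φ(H)`. -/
noncomputable def haarRatio (hφ : IsOpenEmbedding φ) (μH : Measure H) [μH.IsHaarMeasure]
    (μG : Measure G) [μG.IsHaarMeasure] : ℝ :=
  haveI := isHaarMeasure_comap μG hφ
  haarScalarFactor μH (μG.comap φ)

variable (μH : Measure H) [μH.IsHaarMeasure] (μG : Measure G) [μG.IsHaarMeasure]

theorem integral_comap_eq (hφ : IsOpenEmbedding φ) {E : Type*} [NormedAddCommGroup E]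
    [NormedSpace ℝ E] (k : G → E) :
    ∫ y, k (φ y) ∂(μG.comap φ) = ∫ x in Set.range φ, k x ∂μG := by
  rw [← hφ.measurableEmbedding.map_comap, hφ.measurableEmbedding.integral_map]

theorem haarRatio_pos (hφ : IsOpenEmbedding φ) : 0 < haarRatio hφ μH μG := by
  have := isHaarMeasure_comap μG hφ
  exact haarScalarFactor_pos_of_isHaarMeasure μH (μG.comap φ)

theorem integral_comp_eq_real (hφ : IsOpenEmbedding φ) {k : G → ℝ} (hk : Continuous (k ∘ φ))
    (hc : HasCompactSupport (k ∘ φ)) :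
    ∫ y, k (φ y) ∂μH = haarRatio hφ μH μG * ∫ x in Set.range φ, k x ∂μG := by
  have := isHaarMeasure_comap μG hφ
  rw [← integral_comap_eq μG hφ]
  have h := integral_isMulLeftInvariant_eq_smul_of_hasCompactSupport μH (μG.comap φ) hk hc
  rwa [integral_smul_nnreal_measure] at h

theorem integral_comp_eq [LocallyCompactSpace H] (hφ : IsOpenEmbedding φ) {k : G → ℂ}
    (hk : Continuous (k ∘ φ)) (hc : HasCompactSupport (k ∘ φ)) :
    ∫ y, k (φ y) ∂μH = haarRatio hφ μH μG * ∫ x in Set.range φ, k x ∂μG := by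
  have := isHaarMeasure_comap μG hφ
  have hint (m : Measure H) [m.IsHaarMeasure] : Integrable (fun y => k (φ y)) m :=
    Continuous.integrable_of_hasCompactSupport hk hc
  have hintG : Integrable k (μG.restrict (Set.range φ)) := by
    rw [← hφ.measurableEmbedding.map_comap, hφ.measurableEmbedding.integrable_map_iff]
    exact hint _
  have hre := integral_comp_eq_real μH μG hφ (k := fun x => (k x).re)
    (Complex.continuous_re.comp hk) (hc.comp_left Complex.zero_re)
  have him := integral_comp_eq_real μH μG hφ (k := fun x => (k x).im)
    (Complex.continuous_im.comp hk) (hc.comp_left Complex.zero_im)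
  have e1 := Complex.reCLM.integral_comp_comm (hint μH)
  have e2 := Complex.imCLM.integral_comp_comm (hint μH)
  have e3 := Complex.reCLM.integral_comp_comm hintG
  have e4 := Complex.imCLM.integral_comp_comm hintG
  simp only [Complex.reCLM_apply, Complex.imCLM_apply] at e1 e2 e3 e4
  apply Complex.ext
  · rw [Complex.re_ofReal_mul, ← e1, ← e3, hre]
  · rw [Complex.im_ofReal_mul, ← e2, ← e4, him]

/-- A group with an open central subgroup is unimodular: conjugation by `g` preserves the Haar
measure, because it fixes every function supported in the subgroup. -/
theorem modularCharacter_eq_one_of_central [LocallyCompactSpace G] (hφ : IsOpenEmbedding φ)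
    (hc : φ.range ≤ Subgroup.center G) (g : G) : modularCharacter g = 1 := by
  let μG : Measure G := haar
  obtain ⟨⟨u, u_cont⟩, u_comp, u_nonneg, u_one⟩ :
    ∃ u : C(G, ℝ), HasCompactSupport u ∧ 0 ≤ u ∧ u 1 ≠ 0 := exists_continuous_nonneg_pos 1
  have hclopen : IsClopen (Set.range φ) :=
    ⟨(MonoidHom.isClosedEmbedding_of_isOpenEmbedding hφ).isClosed_range, hφ.isOpen_range⟩
  let v : G → ℝ := (Set.range φ).indicator u
  have v_cont : Continuous v := by
    refine u_cont.indicator fun a ha => ?_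
    rw [hclopen.frontier_eq] at ha
    exact ha.elim
  have v_comp : HasCompactSupport v := by
    refine u_comp.mono fun x hx => ?_
    exact fun h => hx (Set.indicator_apply_eq_zero.2 fun _ => h)
  have v_nonneg : 0 ≤ v := fun x => Set.indicator_nonneg (fun y _ => u_nonneg y) x
  have v_one : v 1 ≠ 0 := by
    have : (1 : G) ∈ Set.range φ := ⟨1, map_one φ⟩
    simp only [v, Set.indicator_of_mem this]
    exact u_one
  have hpos : ∫ x, v x ∂μG ≠ 0 :=
    ne_of_gt (v_cont.integral_pos_of_hasCompactSupport_nonneg_nonzero v_comp v_nonneg v_one)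
  have hconj : ∀ x, v (g⁻¹ * (x * g)) = v x := by
    intro x
    by_cases hx : x ∈ φ.range
    · rw [← Subgroup.mem_center_iff.1 (hc hx) g, inv_mul_cancel_left]
    · have hx' : g⁻¹ * (x * g) ∉ φ.range := fun h => hx (by
        have h2 := Subgroup.mem_center_iff.1 (hc h) g
        rw [mul_inv_cancel_left] at h2
        rw [← mul_right_cancel h2] at h
        exact h)
      exact (Set.indicator_of_notMem hx' u).trans (Set.indicator_of_notMem hx u).symm
  change modularCharacterFun g = 1
  rw [modularCharacterFun_eq_haarScalarFactor μG g]
  apply NNReal.coe_injective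
  rw [haarScalarFactor_eq_integral_div _ _ v_cont v_comp hpos,
    integral_map (AEMeasurable.mul_const aemeasurable_id' _)
      (Continuous.aestronglyMeasurable v_cont), NNReal.coe_one, div_eq_one_iff_eq hpos,
    ← integral_mul_left_eq_self (fun x => v x) g⁻¹,
    ← integral_mul_left_eq_self (fun x => v (x * g)) g⁻¹]
  simp only [mul_assoc, hconj]
  rw [integral_mul_left_eq_self (fun x => v x) g⁻¹]

end Integration

/-! ### Translation, extension by zero and restriction -/

namespace ConvAlg

section Translate

variable {G : Type*} [TopologicalSpace G] [Group G] [IsTopologicalGroup G]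
  [MeasurableSpace G] {μ : Measure G}

/-- Left translation on `C_c(G)`: `(translate g f) x = f (g⁻¹ * x)`. -/
def translate (g : G) : ConvAlg G μ →ₗ[ℂ] ConvAlg G μ where
  toFun f := (⟨⟨fun x => f (g⁻¹ * x), f.continuous_coe.comp (continuous_const.mul continuous_id)⟩,
    f.hasCompactSupport.comp_homeomorph (Homeomorph.mulLeft g⁻¹)⟩ : C_c(G, ℂ))
  map_add' _ _ := rfl
  map_smul' _ _ := rfl

theorem translate_apply (g : G) (f : ConvAlg G μ) (x : G) : translate g f x = f (g⁻¹ * x) := rfl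

theorem translate_mul (g h : G) (f : ConvAlg G μ) :
    translate (g * h) f = translate g (translate h f) := by
  apply ext; intro x
  simp [translate_apply, mul_assoc]

theorem translate_one (f : ConvAlg G μ) : translate 1 f = f := by
  apply ext; intro x
  simp [translate_apply]

theorem translate_inv_translate (g : G) (f : ConvAlg G μ) : translate g⁻¹ (translate g f) = f := by
  rw [← translate_mul, inv_mul_cancel, translate_one]

theorem translate_translate_inv (g : G) (f : ConvAlg G μ) : translate g (translate g⁻¹ f) = f := by
  rw [← translate_mul, mul_inv_cancel, translate_one]

variable [LocallyCompactSpace G] [BorelSpace G] [μ.IsHaarMeasure]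

theorem translate_conv (g : G) (f h : ConvAlg G μ) :
    translate g f * h = translate g (f * h) := by
  apply ext; intro x
  rw [translate_apply, mul_apply, mul_apply,
    ← integral_mul_left_eq_self (fun y => translate g f y * h (y⁻¹ * x)) g]
  simp [translate_apply, mul_assoc]

theorem star_apply_of_unimodular (hG : ∀ g : G, Measure.modularCharacter g = 1)
    (f : ConvAlg G μ) (x : G) : (star f) x = star (f x⁻¹) := by
  simp [star_apply, hG]

theorem norm_le_L1 (f : ConvAlg G μ) : ‖f‖ ≤ ∫ x, ‖f x‖ ∂μ := maxNorm_le_L1 f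

end Translate

section Extend

variable {H G : Type*}
  [TopologicalSpace H] [Group H] [IsTopologicalGroup H]
  [MeasurableSpace H] [BorelSpace H]
  [TopologicalSpace G] [Group G] [IsTopologicalGroup G]
  [MeasurableSpace G] [BorelSpace G] {φ : H →* G}

theorem continuous_extend (hφ : IsOpenEmbedding φ) {f : H → ℂ} (hf : Continuous f) :
    Continuous (Function.extend φ f 0) := by
  refine continuous_iff_continuousAt.2 fun x => ?_
  by_cases hx : x ∈ Set.range φ
  · obtain ⟨y, rfl⟩ := hx
    rw [← hφ.continuousAt_iff, Function.extend_comp hφ.injective]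
    exact hf.continuousAt
  · have hopen : (Set.range φ)ᶜ ∈ 𝓝 x :=
      (MonoidHom.isClosedEmbedding_of_isOpenEmbedding hφ).isClosed_range.isOpen_compl.mem_nhds hx
    refine (continuousAt_const (y := (0 : ℂ))).congr ?_
    filter_upwards [hopen] with z hz
    rw [Function.extend_apply' _ _ _ hz, Pi.zero_apply]

theorem hasCompactSupport_extend (hφ : IsOpenEmbedding φ) {f : H → ℂ} (hf : HasCompactSupport f) :
    HasCompactSupport (Function.extend φ f 0) := by
  refine HasCompactSupport.intro' (K := φ '' tsupport f) (hf.isCompact.image hφ.continuous)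
    ((MonoidHom.isClosedEmbedding_of_isOpenEmbedding hφ).isClosedMap _ (isClosed_tsupport f)) ?_
  intro x hx
  by_cases hx' : x ∈ Set.range φ
  · obtain ⟨y, rfl⟩ := hx'
    rw [hφ.injective.extend_apply]
    by_contra h0
    exact hx ⟨y, subset_tsupport _ h0, rfl⟩
  · rw [Function.extend_apply' _ _ _ hx', Pi.zero_apply]

variable {μH : Measure H} [μH.IsHaarMeasure] {μG : Measure G} [μG.IsHaarMeasure]

/-- Extension by zero along an open embedding of groups, rescaled by the ratio of the Haar
measures. -/
noncomputable def extend (hφ : IsOpenEmbedding φ) : ConvAlg H μH →ₗ[ℂ] ConvAlg G μG where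
  toFun f := (⟨⟨fun x => haarRatio hφ μH μG * Function.extend φ f 0 x,
    continuous_const.mul (continuous_extend hφ f.continuous_coe)⟩,
    (hasCompactSupport_extend hφ f.hasCompactSupport).mul_left⟩ : C_c(G, ℂ))
  map_add' f g := by
    apply ext; intro x
    change (haarRatio hφ μH μG : ℂ) * Function.extend φ (f + g) 0 x =
      haarRatio hφ μH μG * Function.extend φ f 0 x + haarRatio hφ μH μG * Function.extend φ g 0 x
    by_cases hx : x ∈ Set.range φ
    · obtain ⟨y, rfl⟩ := hx
      simp only [hφ.injective.extend_apply, add_apply, mul_add]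
    · simp only [Function.extend_apply' _ _ _ hx, Pi.zero_apply, mul_zero, add_zero]
  map_smul' c f := by
    apply ext; intro x
    change (haarRatio hφ μH μG : ℂ) * Function.extend φ (c • f) 0 x =
      c * (haarRatio hφ μH μG * Function.extend φ f 0 x)
    by_cases hx : x ∈ Set.range φ
    · obtain ⟨y, rfl⟩ := hx
      simp only [hφ.injective.extend_apply, smul_apply]
      ring
    · simp only [Function.extend_apply' _ _ _ hx, Pi.zero_apply, mul_zero]

theorem extend_apply (hφ : IsOpenEmbedding φ) (f : ConvAlg H μH) (x : G) :
    (extend hφ f : ConvAlg G μG) x = haarRatio hφ μH μG * Function.extend φ f 0 x := rfl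

theorem extend_apply_map (hφ : IsOpenEmbedding φ) (f : ConvAlg H μH) (y : H) :
    (extend hφ f : ConvAlg G μG) (φ y) = haarRatio hφ μH μG * f y := by
  rw [extend_apply, hφ.injective.extend_apply]

theorem extend_apply_of_notMem (hφ : IsOpenEmbedding φ) (f : ConvAlg H μH) {x : G}
    (hx : x ∉ φ.range) : (extend hφ f : ConvAlg G μG) x = 0 := by
  rw [extend_apply, Function.extend_apply' _ _ _ hx, Pi.zero_apply, mul_zero]

/-- Restriction to an open subgroup, rescaled so as to be a left inverse of `extend`. -/
noncomputable def restrict (hφ : IsOpenEmbedding φ) : ConvAlg G μG →ₗ[ℂ] ConvAlg H μH where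
  toFun F := (⟨⟨fun y => (haarRatio hφ μH μG : ℂ)⁻¹ * F (φ y),
    continuous_const.mul (F.continuous_coe.comp hφ.continuous)⟩,
    (F.hasCompactSupport.comp_isClosedEmbedding
      (MonoidHom.isClosedEmbedding_of_isOpenEmbedding hφ)).mul_left⟩ : C_c(H, ℂ))
  map_add' f g := by
    apply ext; intro y
    exact mul_add _ _ _
  map_smul' c f := by
    apply ext; intro y
    exact mul_left_comm _ _ _

theorem restrict_apply (hφ : IsOpenEmbedding φ) (F : ConvAlg G μG) (y : H) :
    (restrict hφ F : ConvAlg H μH) y = (haarRatio hφ μH μG : ℂ)⁻¹ * F (φ y) := rfl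

theorem haarRatio_ne_zero (hφ : IsOpenEmbedding φ) : (haarRatio hφ μH μG : ℂ) ≠ 0 :=
  Complex.ofReal_ne_zero.2 (haarRatio_pos μH μG hφ).ne'

theorem restrict_extend (hφ : IsOpenEmbedding φ) (f : ConvAlg H μH) :
    restrict hφ (extend hφ f : ConvAlg G μG) = f := by
  apply ext; intro y
  rw [restrict_apply, extend_apply_map, inv_mul_cancel_left₀ (haarRatio_ne_zero hφ)]

theorem extend_translate (hφ : IsOpenEmbedding φ) (l : H) (f : ConvAlg H μH) :
    (extend hφ (translate l f) : ConvAlg G μG) = translate (φ l) (extend hφ f) := by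
  apply ext; intro x
  rw [translate_apply]
  by_cases hx : x ∈ φ.range
  · obtain ⟨y, rfl⟩ := hx
    rw [← map_inv, ← map_mul, extend_apply_map, extend_apply_map, translate_apply]
  · rw [extend_apply_of_notMem hφ _ hx, extend_apply_of_notMem]
    rwa [Subgroup.mul_mem_cancel_left]
    exact inv_mem ⟨l, rfl⟩

theorem restrict_translate (hφ : IsOpenEmbedding φ) (l : H) (F : ConvAlg G μG) :
    (restrict hφ (translate (φ l) F) : ConvAlg H μH) = translate l (restrict hφ F) := by
  apply ext; intro y
  rw [translate_apply, restrict_apply, restrict_apply, translate_apply, map_mul φ, map_inv φ]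

theorem restrict_translate_extend_of_notMem (hφ : IsOpenEmbedding φ) {g : G} (hg : g ∉ φ.range)
    (f : ConvAlg H μH) : restrict hφ (translate g (extend hφ f : ConvAlg G μG)) =
      (0 : ConvAlg H μH) := by
  apply ext; intro y
  rw [restrict_apply, translate_apply, extend_apply_of_notMem, mul_zero, zero_apply]
  rwa [Subgroup.mul_mem_cancel_right _ (MonoidHom.mem_range.2 ⟨y, rfl⟩), inv_mem_iff]

theorem integral_norm_restrict (hφ : IsOpenEmbedding φ) (F : ConvAlg G μG) :
    ∫ y, ‖(restrict hφ F : ConvAlg H μH) y‖ ∂μH = ∫ x in Set.range φ, ‖F x‖ ∂μG := by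
  have h := integral_comp_eq_real μH μG hφ (k := fun x => (haarRatio hφ μH μG)⁻¹ * ‖F x‖)
    (continuous_const.mul (F.continuous_coe.norm.comp hφ.continuous))
    ((F.hasCompactSupport.norm.comp_isClosedEmbedding
      (MonoidHom.isClosedEmbedding_of_isOpenEmbedding hφ)).mul_left)
  have hpos := haarRatio_pos μH μG hφ
  rw [integral_const_mul (μ := μG.restrict _), mul_inv_cancel_left₀ hpos.ne'] at h
  rw [← h]
  congr 1 with y
  rw [restrict_apply, norm_mul, norm_inv, Complex.norm_real, Real.norm_of_nonneg hpos.le]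

theorem integral_norm_extend (hφ : IsOpenEmbedding φ) (f : ConvAlg H μH) :
    ∫ x, ‖(extend hφ f : ConvAlg G μG) x‖ ∂μG = ∫ y, ‖f y‖ ∂μH := by
  rw [← setIntegral_eq_integral_of_forall_compl_eq_zero (s := Set.range φ),
    ← integral_norm_restrict (μH := μH) hφ, restrict_extend]
  intro x hx
  rw [extend_apply_of_notMem hφ f hx, norm_zero]

variable [LocallyCompactSpace H] [LocallyCompactSpace G]

theorem extend_mul_apply (hφ : IsOpenEmbedding φ) (a : ConvAlg H μH) (Z : ConvAlg G μG) (x : G) :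
    (extend hφ a * Z : ConvAlg G μG) x = ∫ y, a y * Z ((φ y)⁻¹ * x) ∂μH := by
  have h := integral_comp_eq μH μG hφ (k := fun y => Function.extend φ a 0 y * Z (y⁻¹ * x))
    (by
      refine Continuous.mul ?_ (Z.continuous_coe.comp (by have := hφ.continuous; fun_prop))
      exact (continuous_extend hφ a.continuous_coe).comp hφ.continuous)
    (by
      refine HasCompactSupport.mul_right ?_
      exact (hasCompactSupport_extend hφ a.hasCompactSupport).comp_isClosedEmbedding
        (MonoidHom.isClosedEmbedding_of_isOpenEmbedding hφ))
  simp only [hφ.injective.extend_apply] at h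
  rw [h, mul_apply, ← integral_const_mul,
    ← setIntegral_eq_integral_of_forall_compl_eq_zero (s := Set.range φ)]
  · simp only [extend_apply, mul_assoc]
  · intro y hy
    rw [extend_apply_of_notMem hφ a hy, zero_mul]

theorem restrict_extend_mul (hφ : IsOpenEmbedding φ) (a : ConvAlg H μH) (Z : ConvAlg G μG) :
    restrict hφ (extend hφ a * Z : ConvAlg G μG) = a * restrict hφ Z := by
  apply ext; intro y
  rw [restrict_apply, extend_mul_apply, mul_apply, ← integral_const_mul]
  congr 1 with z
  rw [restrict_apply, map_mul φ, map_inv φ]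
  ring

theorem extend_mul (hφ : IsOpenEmbedding φ) (a b : ConvAlg H μH) :
    (extend hφ (a * b) : ConvAlg G μG) = extend hφ a * extend hφ b := by
  apply ext; intro x
  by_cases hx : x ∈ φ.range
  · obtain ⟨y, rfl⟩ := hx
    rw [extend_mul_apply, extend_apply_map, mul_apply, ← integral_const_mul]
    congr 1 with z
    rw [← map_inv, ← map_mul, extend_apply_map]
    ring
  · rw [extend_apply_of_notMem hφ _ hx, extend_mul_apply, eq_comm]
    rw [← integral_zero H ℂ (μ := μH)]
    congr 1 with z
    rw [extend_apply_of_notMem, mul_zero]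
    rwa [Subgroup.mul_mem_cancel_left _ (inv_mem (MonoidHom.mem_range.2 ⟨z, rfl⟩))]

theorem extend_star (hφ : IsOpenEmbedding φ) (hH : ∀ h : H, Measure.modularCharacter h = 1)
    (hG : ∀ g : G, Measure.modularCharacter g = 1) (a : ConvAlg H μH) :
    (extend hφ (star a) : ConvAlg G μG) = star (extend hφ a) := by
  apply ext; intro x
  rw [star_apply_of_unimodular hG]
  by_cases hx : x ∈ φ.range
  · obtain ⟨y, rfl⟩ := hx
    rw [extend_apply_map, ← map_inv, extend_apply_map, star_apply_of_unimodular hH]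
    simp
  · rw [extend_apply_of_notMem hφ _ hx, extend_apply_of_notMem hφ _ (by rwa [inv_mem_iff]),
      star_zero]

/-- Extension by zero as a *-homomorphism of convolution algebras, for unimodular groups. -/
noncomputable def extendHom (hφ : IsOpenEmbedding φ)
    (hH : ∀ h : H, Measure.modularCharacter h = 1) (hG : ∀ g : G, Measure.modularCharacter g = 1) :
    ConvAlg H μH →⋆ₙₐ[ℂ] ConvAlg G μG where
  toFun := extend hφ
  map_smul' := map_smul _
  map_zero' := map_zero _
  map_add' := map_add _
  map_mul' := extend_mul hφ
  map_star' := extend_star hφ hH hG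

theorem extend_mul_translate (hφ : IsOpenEmbedding φ) (hc : φ.range ≤ Subgroup.center G)
    (a : ConvAlg H μH) (g : G) (Z : ConvAlg G μG) :
    (extend hφ a * translate g Z : ConvAlg G μG) = translate g (extend hφ a * Z) := by
  apply ext; intro x
  rw [translate_apply, extend_mul_apply, extend_mul_apply]
  congr 1 with y
  rw [translate_apply, ← mul_assoc, ← mul_assoc,
    Subgroup.mem_center_iff.1 (hc (inv_mem (MonoidHom.mem_range.2 ⟨y, rfl⟩))) g⁻¹]

theorem star_translate_extend (hφ : IsOpenEmbedding φ) (hc : φ.range ≤ Subgroup.center G)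
    (hH : ∀ h : H, Measure.modularCharacter h = 1) (hG : ∀ g : G, Measure.modularCharacter g = 1)
    (a : ConvAlg H μH) (g : G) :
    star (translate g (extend hφ a) : ConvAlg G μG) = translate g⁻¹ (extend hφ (star a)) := by
  rw [extend_star hφ hH hG]
  apply ext; intro x
  rw [star_apply_of_unimodular hG, translate_apply, translate_apply, star_apply_of_unimodular hG,
    inv_inv, mul_inv_rev]
  congr 1
  by_cases hx : g⁻¹ * x⁻¹ ∈ φ.range
  · have h := Subgroup.mem_center_iff.1 (hc hx) g
    rw [mul_inv_cancel_left] at h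
    nth_rewrite 2 [h]
    rw [mul_inv_cancel_right]
  · have hx' : x⁻¹ * g⁻¹ ∉ φ.range := fun h' => hx (by
      have h := Subgroup.mem_center_iff.1 (hc h') g⁻¹
      have h2 : g⁻¹ * x⁻¹ = x⁻¹ * g⁻¹ := mul_right_cancel (b := g⁻¹) (by rw [mul_assoc, h])
      rwa [h2])
    rw [extend_apply_of_notMem hφ _ hx, extend_apply_of_notMem hφ _ hx']

theorem translate_extend_mul (hφ : IsOpenEmbedding φ) (hc : φ.range ≤ Subgroup.center G)
    (a b : ConvAlg H μH) (g h : G) :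
    (translate g (extend hφ a) * translate h (extend hφ b) : ConvAlg G μG) =
      translate (g * h) (extend hφ (a * b)) := by
  rw [translate_conv, extend_mul_translate hφ hc, ← translate_mul, extend_mul]

theorem star_translate_extend_mul_self (hφ : IsOpenEmbedding φ)
    (hc : φ.range ≤ Subgroup.center G)
    (hH : ∀ h : H, Measure.modularCharacter h = 1) (hG : ∀ g : G, Measure.modularCharacter g = 1)
    (a b : ConvAlg H μH) (g : G) :
    (star (translate g (extend hφ a)) * translate g (extend hφ b) : ConvAlg G μG) =
      extend hφ (star a * b) := by
  rw [star_translate_extend hφ hc hH hG, translate_extend_mul hφ hc, inv_mul_cancel, translate_one]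

end Extend

end ConvAlg

/-! ### *-homomorphisms out of the full group C*-algebra -/

namespace FullGroupCStar

section Lift

variable {G : Type*} [TopologicalSpace G] [Group G] [IsTopologicalGroup G] [LocallyCompactSpace G]
  [MeasurableSpace G] [BorelSpace G] {μ : Measure G} [μ.IsHaarMeasure]
  {D : Type*} [NonUnitalCStarAlgebra D]

/-- The canonical map `C_c(G) → C*(G)` as a *-homomorphism. -/
noncomputable def ofHom : ConvAlg G μ →⋆ₙₐ[ℂ] FullGroupCStar G μ where
  toFun := of
  map_smul' := of_smul
  map_zero' := of_zero
  map_add' := of_add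
  map_mul' := of_mul
  map_star' := of_star

/-- A *-homomorphism bounded by the `L¹`-norm is bounded by the maximal C*-norm, since
`f ↦ ‖θ f‖` is one of the seminorms whose supremum is the latter. -/
theorem norm_hom_le (θ : ConvAlg G μ →⋆ₙₐ[ℂ] D) (hθ : ∀ f, ‖θ f‖ ≤ ∫ x, ‖f x‖ ∂μ)
    (f : ConvAlg G μ) : ‖θ f‖ ≤ ‖f‖ := by
  let p : Seminorm ℂ (ConvAlg G μ) := Seminorm.of (fun f => ‖θ f‖)
    (fun f g => by simpa using norm_add_le (θ f) (θ g))
    (fun c f => by rw [map_smul, norm_smul])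
  have hp : ConvAlg.IsCStarSeminorm p :=
    { mul_le := fun f g => by
        change ‖θ (f * g)‖ ≤ ‖θ f‖ * ‖θ g‖
        rw [map_mul]; exact norm_mul_le _ _
      star_mul_self := fun f => by
        change ‖θ (star f * f)‖ = ‖θ f‖ ^ 2
        rw [map_mul, map_star, CStarRing.norm_star_mul_self, sq]
      le_L1 := hθ }
  exact ConvAlg.le_maxNorm hp f

theorem denseRange_ofHom :
    DenseRange (((ofHom : ConvAlg G μ →⋆ₙₐ[ℂ] _) : ConvAlg G μ →ₗ[ℂ] FullGroupCStar G μ)) :=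
  denseRange_of

/-- The extension to `C*(G)` of a *-homomorphism on `C_c(G)` bounded by the `L¹`-norm. -/
noncomputable def lift (θ : ConvAlg G μ →⋆ₙₐ[ℂ] D) (hθ : ∀ f, ‖θ f‖ ≤ ∫ x, ‖f x‖ ∂μ) :
    FullGroupCStar G μ →⋆ₙₐ[ℂ] D :=
  let L : FullGroupCStar G μ →L[ℂ] D := (θ : ConvAlg G μ →ₗ[ℂ] D).extendOfNorm
    ((ofHom : ConvAlg G μ →⋆ₙₐ[ℂ] _) : ConvAlg G μ →ₗ[ℂ] FullGroupCStar G μ)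
  have hL (f : ConvAlg G μ) : L (of f) = θ f :=
    LinearMap.extendOfNorm_eq denseRange_ofHom
      ⟨1, fun f => by rw [one_mul]; exact (norm_hom_le θ hθ f).trans (norm_of f).ge⟩ f
  { toFun := L
    map_smul' := map_smul L
    map_zero' := map_zero L
    map_add' := map_add L
    map_mul' := fun a b => by
      induction a, b using induction_on₂ with
      | hP => exact isClosed_eq (by fun_prop) (by fun_prop)
      | h f g => rw [← of_mul, hL, hL, hL, map_mul]
    map_star' := fun a => by
      induction a using induction_on with
      | hP => exact isClosed_eq (L.continuous.comp continuous_star) (L.continuous.star)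
      | h f => rw [← of_star, hL, hL, map_star] }

theorem lift_of (θ : ConvAlg G μ →⋆ₙₐ[ℂ] D) (hθ : ∀ f, ‖θ f‖ ≤ ∫ x, ‖f x‖ ∂μ) (f : ConvAlg G μ) :
    lift θ hθ (of f) = θ f :=
  LinearMap.extendOfNorm_eq denseRange_ofHom
    ⟨1, fun f => by rw [one_mul]; exact (norm_hom_le θ hθ f).trans (norm_of f).ge⟩ f

theorem continuous_hom (Φ : FullGroupCStar G μ →⋆ₙₐ[ℂ] D) : Continuous Φ :=
  AddMonoidHomClass.continuous_of_bound Φ 1 fun a => by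
    rw [one_mul]; exact NonUnitalStarAlgHom.norm_apply_le Φ a

theorem hom_ext {Φ Ψ : FullGroupCStar G μ →⋆ₙₐ[ℂ] D} (h : ∀ f, Φ (of f) = Ψ (of f)) : Φ = Ψ := by
  ext a
  induction a using induction_on with
  | hP => exact isClosed_eq (continuous_hom Φ) (continuous_hom Ψ)
  | h f => exact h f

/-- Every element of `C_c(G)` is approximated, in the C*-norm, by its products with suitable
elements of `C_c(G)`. -/
theorem exists_norm_mul_sub_lt (f : ConvAlg G μ) {ε : ℝ} (hε : 0 < ε) :
    ∃ e : ConvAlg G μ, ‖e * f - f‖ < ε := by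
  let _ := CStarAlgebra.spectralOrder (FullGroupCStar G μ)
  have := CStarAlgebra.spectralOrderedRing (FullGroupCStar G μ)
  have h := (CStarAlgebra.increasingApproximateUnit (FullGroupCStar G μ)).tendsto_mul_right (of f)
  obtain ⟨a, ha⟩ := (h.eventually (Metric.ball_mem_nhds _ hε)).exists
  have hopen : IsOpen {a : FullGroupCStar G μ | a * of f ∈ Metric.ball (of f) ε} :=
    Metric.isOpen_ball.preimage (by fun_prop)
  obtain ⟨e, he⟩ := denseRange_of.exists_mem_open hopen ⟨a, ha⟩
  refine ⟨e, ?_⟩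
  rw [Set.mem_ofPred_eq, ← of_mul, mem_ball_iff_norm, sub_eq_add_neg, ← neg_one_smul ℂ (of f),
    ← of_smul, ← of_add, norm_of, neg_one_smul, ← sub_eq_add_neg] at he
  exact he

end Lift

section Induced

variable {H G : Type*}
  [TopologicalSpace H] [Group H] [IsTopologicalGroup H] [LocallyCompactSpace H]
  [MeasurableSpace H] [BorelSpace H]
  [TopologicalSpace G] [Group G] [IsTopologicalGroup G] [LocallyCompactSpace G]
  [MeasurableSpace G] [BorelSpace G] {φ : H →* G}
  {μH : Measure H} [μH.IsHaarMeasure] {μG : Measure G} [μG.IsHaarMeasure]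

/-- The *-homomorphism `C*(H) → C*(G)` induced by an open embedding of unimodular groups. -/
noncomputable def induced (hφ : IsOpenEmbedding φ) (hH : ∀ h : H, Measure.modularCharacter h = 1)
    (hG : ∀ g : G, Measure.modularCharacter g = 1) :
    FullGroupCStar H μH →⋆ₙₐ[ℂ] FullGroupCStar G μG :=
  lift (ofHom.comp (ConvAlg.extendHom hφ hH hG)) fun f => by
    refine ((norm_of _).le.trans (ConvAlg.norm_le_L1 _)).trans ?_
    exact (ConvAlg.integral_norm_extend hφ f).le

theorem induced_of (hφ : IsOpenEmbedding φ) (hH : ∀ h : H, Measure.modularCharacter h = 1)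
    (hG : ∀ g : G, Measure.modularCharacter g = 1) (f : ConvAlg H μH) :
    (induced hφ hH hG (of f) : FullGroupCStar G μG) = of (ConvAlg.extend hφ f) :=
  lift_of _ _ f

theorem isInducedHom_induced (hφ : IsOpenEmbedding φ)
    (hH : ∀ h : H, Measure.modularCharacter h = 1) (hG : ∀ g : G, Measure.modularCharacter g = 1) :
    IsInducedHom φ μH μG (induced hφ hH hG) :=
  ⟨haarRatio hφ μH μG, haarRatio_pos μH μG hφ,
    fun k => integral_comp_eq μH μG hφ (k.continuous.comp hφ.continuous)
      (k.hasCompactSupport'.comp_isClosedEmbedding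
        (MonoidHom.isClosedEmbedding_of_isOpenEmbedding hφ)),
    fun f => ⟨ConvAlg.extend hφ f, fun _ => rfl, induced_of hφ hH hG f⟩⟩

end Induced

end FullGroupCStar

/-! ### Decomposition over the cosets of an open subgroup -/

namespace ConvAlg

section Coset

variable {H G : Type*}
  [TopologicalSpace H] [Group H] [IsTopologicalGroup H]
  [MeasurableSpace H] [BorelSpace H]
  [TopologicalSpace G] [Group G] [IsTopologicalGroup G]
  [MeasurableSpace G] [BorelSpace G] {φ : H →* G}
  {μH : Measure H} [μH.IsHaarMeasure] {μG : Measure G} [μG.IsHaarMeasure]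

/-- The component of `F` on the coset `g φ(H)`, carried back to `H`. -/
noncomputable def component (hφ : IsOpenEmbedding φ) (g : G) : ConvAlg G μG →ₗ[ℂ] ConvAlg H μH :=
  (restrict hφ).comp (translate g⁻¹)

theorem component_apply (hφ : IsOpenEmbedding φ) (g : G) (F : ConvAlg G μG) :
    (component hφ g F : ConvAlg H μH) = restrict hφ (translate g⁻¹ F) := rfl

theorem component_mul_map (hφ : IsOpenEmbedding φ) (g : G) (l : H) (F : ConvAlg G μG) :
    (component hφ (g * φ l) F : ConvAlg H μH) = translate l⁻¹ (component hφ g F) := by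
  rw [component_apply, component_apply, mul_inv_rev, translate_mul, ← map_inv, restrict_translate]

theorem component_translate_extend (hφ : IsOpenEmbedding φ) (g : G) (f : ConvAlg H μH) :
    (component hφ g (translate g (extend hφ f) : ConvAlg G μG)) = f := by
  rw [component_apply, translate_inv_translate, restrict_extend]

theorem component_translate_extend_of_ne (hφ : IsOpenEmbedding φ) {g h : G}
    (hgh : (g : G ⧸ φ.range) ≠ h) (f : ConvAlg H μH) :
    (component hφ g (translate h (extend hφ f) : ConvAlg G μG)) = (0 : ConvAlg H μH) := by
  rw [component_apply, ← translate_mul, restrict_translate_extend_of_notMem]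
  exact fun h' => hgh (QuotientGroup.eq.2 h')

theorem translate_extend_component_apply (hφ : IsOpenEmbedding φ) (g : G) (F : ConvAlg G μG)
    {x : G} (hx : (x : G ⧸ φ.range) = g) :
    (translate g (extend hφ (component hφ g F : ConvAlg H μH)) : ConvAlg G μG) x = F x := by
  obtain ⟨l, hl⟩ := QuotientGroup.eq.1 hx.symm
  rw [translate_apply, ← hl, extend_apply_map, component_apply, restrict_apply,
    mul_inv_cancel_left₀ (haarRatio_ne_zero hφ), translate_apply, hl, inv_inv,
    mul_inv_cancel_left]

theorem translate_extend_apply_of_ne (hφ : IsOpenEmbedding φ) (g : G) (f : ConvAlg H μH)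
    {x : G} (hx : (x : G ⧸ φ.range) ≠ g) :
    (translate g (extend hφ f) : ConvAlg G μG) x = 0 := by
  rw [translate_apply, extend_apply_of_notMem]
  exact fun h => hx (QuotientGroup.eq.2 h).symm

theorem finite_component_ne_zero (hφ : IsOpenEmbedding φ) (F : ConvAlg G μG) :
    {q : G ⧸ φ.range | (component hφ q.out F : ConvAlg H μH) ≠ 0}.Finite := by
  have : DiscreteTopology (G ⧸ φ.range) := QuotientGroup.discreteTopology hφ.isOpen_range
  have hK : (QuotientGroup.mk '' tsupport F : Set (G ⧸ φ.range)).Finite :=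
    (F.hasCompactSupport.isCompact.image QuotientGroup.continuous_mk).finite_of_discrete
  refine hK.subset fun q hq => ?_
  by_contra h
  refine hq (ext fun y => ?_)
  rw [component_apply, restrict_apply, translate_apply, inv_inv, zero_apply]
  have : F (q.out * φ y) = 0 := by
    by_contra h0
    refine h ⟨_, subset_tsupport _ h0, ?_⟩
    rw [QuotientGroup.mk_mul_of_mem _ (MonoidHom.mem_range.2 ⟨y, rfl⟩), QuotientGroup.out_eq']
  rw [this, mul_zero]

theorem sum_apply {ι : Type*} (s : Finset ι) (f : ι → ConvAlg G μG) (x : G) :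
    (∑ i ∈ s, f i) x = ∑ i ∈ s, f i x := by
  induction s using Finset.cons_induction with
  | empty => rfl
  | cons i s hi ih => rw [Finset.sum_cons, Finset.sum_cons, add_apply, ih]

theorem sum_translate_extend_component (hφ : IsOpenEmbedding φ) (F : ConvAlg G μG) :
    ∑ q ∈ (finite_component_ne_zero (μH := μH) hφ F).toFinset,
      translate q.out (extend hφ (component hφ q.out F : ConvAlg H μH)) = F := by
  apply ext; intro x
  rw [sum_apply, Finset.sum_eq_single (x : G ⧸ φ.range)]
  · exact translate_extend_component_apply hφ _ F (QuotientGroup.out_eq' _).symm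
  · intro q _ hq
    refine translate_extend_apply_of_ne hφ _ _ ?_
    rw [QuotientGroup.out_eq']
    exact hq.symm
  · intro hx
    have : (component hφ (x : G ⧸ φ.range).out F : ConvAlg H μH) = 0 := by simpa using hx
    rw [this, map_zero, map_zero, zero_apply]

/-- The translates of functions supported in the open subgroup span `C_c(G)`. -/
theorem induction_translate_extend (hφ : IsOpenEmbedding φ)
    {P : ConvAlg G μG → Prop} (F : ConvAlg G μG)
    (zero : P 0) (add : ∀ F K, P F → P K → P (F + K))
    (translate_extend : ∀ (g : G) (f : ConvAlg H μH), P (translate g (extend hφ f))) : P F := by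
  rw [← sum_translate_extend_component (μH := μH) hφ F]
  exact Finset.sum_induction _ P add zero fun q _ => translate_extend _ _

theorem integrable_norm [LocallyCompactSpace G] (F : ConvAlg G μG) :
    Integrable (fun x => ‖F x‖) μG :=
  F.continuous_coe.norm.integrable_of_hasCompactSupport F.hasCompactSupport.norm

theorem sum_integral_norm_component_le [LocallyCompactSpace G] (hφ : IsOpenEmbedding φ)
    (F : ConvAlg G μG) (s : Finset (G ⧸ φ.range)) :
    ∑ q ∈ s, ∫ y, ‖(component hφ q.out F : ConvAlg H μH) y‖ ∂μH ≤ ∫ x, ‖F x‖ ∂μG := by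
  have h1 : ∀ q : G ⧸ φ.range, ∫ y, ‖(component hφ q.out F : ConvAlg H μH) y‖ ∂μH =
      ∫ x, ‖(translate q.out (extend hφ (component hφ q.out F : ConvAlg H μH)) :
        ConvAlg G μG) x‖ ∂μG := by
    intro q
    rw [← integral_norm_extend (μG := μG) hφ]
    exact (integral_mul_left_eq_self (fun x => ‖(extend hφ (component hφ q.out F : ConvAlg H μH) :
      ConvAlg G μG) x‖) q.out⁻¹).symm
  simp_rw [h1]
  rw [← integral_finsetSum _ fun q _ => integrable_norm _]
  refine integral_mono (integrable_finsetSum _ fun q _ => integrable_norm _) (integrable_norm F)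
    fun x => ?_
  change ∑ q ∈ s, ‖_‖ ≤ ‖F x‖
  by_cases hx : (x : G ⧸ φ.range) ∈ s
  · rw [Finset.sum_eq_single_of_mem _ hx,
      translate_extend_component_apply hφ _ F (QuotientGroup.out_eq' _).symm]
    intro q _ hq
    rw [translate_extend_apply_of_ne, norm_zero]
    rw [QuotientGroup.out_eq']
    exact hq.symm
  · rw [Finset.sum_eq_zero]
    · exact norm_nonneg _
    · intro q hq
      rw [translate_extend_apply_of_ne, norm_zero]
      rw [QuotientGroup.out_eq']
      rintro rfl
      exact hx hq

/-- The linear map on `C_c(G)` assembled from linear maps `W g` on `C_c(H)`: the component of a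
function on a coset `q` is mapped by `W` at the chosen representative `q.out`. -/
noncomputable def cosetSum (hφ : IsOpenEmbedding φ) {D : Type*} [AddCommGroup D] [Module ℂ D]
    (W : G → ConvAlg H μH →ₗ[ℂ] D) : ConvAlg G μG →ₗ[ℂ] D where
  toFun F := ∑ᶠ q : G ⧸ φ.range, W q.out (component hφ q.out F)
  map_add' F K := by
    simp only [map_add]
    refine finsum_add_distrib
      ((finite_component_ne_zero (μH := μH) hφ F).subset fun q hq h => hq ?_)
      ((finite_component_ne_zero (μH := μH) hφ K).subset fun q hq h => hq ?_) <;>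
    · change W _ _ = 0
      rw [h, map_zero]
  map_smul' c F := by
    simp only [map_smul, RingHom.id_apply]
    exact (smul_finsum' c ((finite_component_ne_zero (μH := μH) hφ F).subset fun q hq h => hq
      (by change W _ _ = 0; rw [h, map_zero]))).symm

theorem cosetSum_apply (hφ : IsOpenEmbedding φ) {D : Type*} [AddCommGroup D] [Module ℂ D]
    (W : G → ConvAlg H μH →ₗ[ℂ] D) (F : ConvAlg G μG) {s : Finset (G ⧸ φ.range)}
    (hs : ∀ q : G ⧸ φ.range, (component hφ q.out F : ConvAlg H μH) ≠ 0 → q ∈ s) :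
    cosetSum hφ W F = ∑ q ∈ s, W q.out (component hφ q.out F) :=
  finsum_eq_sum_of_support_subset _ fun q hq => hs q fun h => hq
    (by change W _ _ = 0; rw [h, map_zero])

theorem cosetSum_translate_extend (hφ : IsOpenEmbedding φ) {D : Type*} [AddCommGroup D]
    [Module ℂ D] (W : G → ConvAlg H μH →ₗ[ℂ] D)
    (hW : ∀ g l f, W (g * φ l) f = W g (translate l f)) (g : G) (f : ConvAlg H μH) :
    cosetSum hφ W (translate g (extend hφ f) : ConvAlg G μG) = W g f := by
  rw [cosetSum_apply hφ W _ (s := {(g : G ⧸ φ.range)}), Finset.sum_singleton]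
  · obtain ⟨l, hl⟩ := QuotientGroup.eq.1 (QuotientGroup.out_eq' (g : G ⧸ φ.range)).symm
    have hl' : (g : G ⧸ φ.range).out = g * φ l := by rw [hl, mul_inv_cancel_left]
    rw [hl', hW, component_mul_map, component_translate_extend, translate_translate_inv]
  · intro q hq
    by_contra h
    refine hq (component_translate_extend_of_ne hφ ?_ f)
    rw [QuotientGroup.out_eq']
    exact fun h' => h (Finset.mem_singleton.2 h')

theorem norm_cosetSum_le [LocallyCompactSpace G] (hφ : IsOpenEmbedding φ) {D : Type*}
    [NormedAddCommGroup D] [NormedSpace ℂ D] (W : G → ConvAlg H μH →ₗ[ℂ] D)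
    (hW : ∀ g f, ‖W g f‖ ≤ ∫ y, ‖f y‖ ∂μH) (F : ConvAlg G μG) :
    ‖cosetSum hφ W F‖ ≤ ∫ x, ‖F x‖ ∂μG := by
  rw [cosetSum_apply hφ W F (s := (finite_component_ne_zero (μH := μH) hφ F).toFinset)
    fun q hq => by simpa using hq]
  exact (norm_sum_le_of_le _ fun q _ => hW _ _).trans (sum_integral_norm_component_le hφ F _)

/-- A *-homomorphism on `C_c(G)` assembled from maps on the cosets of an open central subgroup. The
condition `hW` makes it independent of the choice of representatives. -/
noncomputable def cosetHom [LocallyCompactSpace H] [LocallyCompactSpace G]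
    (hφ : IsOpenEmbedding φ) (hc : φ.range ≤ Subgroup.center G)
    (hH : ∀ h : H, Measure.modularCharacter h = 1) (hG : ∀ g : G, Measure.modularCharacter g = 1)
    {D : Type*} [NonUnitalCStarAlgebra D]
    (W : G → ConvAlg H μH →ₗ[ℂ] D) (hW : ∀ g l f, W (g * φ l) f = W g (translate l f))
    (hmul : ∀ g h a b, W (g * h) (a * b) = W g a * W h b)
    (hstar : ∀ g a, W g⁻¹ (star a) = star (W g a)) : ConvAlg G μG →⋆ₙₐ[ℂ] D where
  toFun := cosetSum hφ W
  map_smul' := map_smul _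
  map_zero' := map_zero _
  map_add' := map_add _
  map_mul' F K := by
    change cosetSum hφ W (F * K) = cosetSum hφ W F * cosetSum hφ W K
    induction F using induction_translate_extend (μH := μH) (μG := μG) hφ with
    | zero => simp
    | add F F' h h' => rw [add_mul, map_add, map_add, add_mul, h, h']
    | translate_extend g f =>
      induction K using induction_translate_extend (μH := μH) (μG := μG) hφ with
      | zero => simp
      | add F F' h h' => rw [mul_add, map_add, map_add, mul_add, h, h']
      | translate_extend k f' =>
        rw [translate_extend_mul hφ hc, cosetSum_translate_extend hφ W hW,
          cosetSum_translate_extend hφ W hW, cosetSum_translate_extend hφ W hW, hmul]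
  map_star' F := by
    induction F using induction_translate_extend (μH := μH) (μG := μG) hφ with
    | zero => simp
    | add F F' h h' => rw [star_add, map_add, map_add, star_add, h, h']
    | translate_extend g f =>
      rw [star_translate_extend hφ hc hH hG, cosetSum_translate_extend hφ W hW,
        cosetSum_translate_extend hφ W hW, hstar]

end Coset

end ConvAlg

/-! ### Isometry of the inclusion of the algebra of a central open subgroup -/

namespace ConvAlg

section OperatorSeminorm

variable {G : Type*} [TopologicalSpace G] [Group G] [IsTopologicalGroup G] [LocallyCompactSpace G]
  [MeasurableSpace G] [BorelSpace G] {μ : Measure G} [μ.IsHaarMeasure]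

/-- If `C_c(G)` acts on itself by left multiplication in an adjointable and `L¹`-contractive way
with respect to a seminorm `N` coming from an inner product, then the operator norm is a
C*-seminorm, and so the action is contractive for the maximal C*-norm. -/
theorem mul_le_norm_mul (N : Seminorm ℂ (ConvAlg G μ))
    (hN : ∀ F X, N (F * X) ^ 2 ≤ N X * N (star F * F * X))
    (hL : ∀ F X, N (F * X) ≤ (∫ x, ‖F x‖ ∂μ) * N X) (F X : ConvAlg G μ) :
    N (F * X) ≤ ‖F‖ * N X := by
  have : Nonempty {X : ConvAlg G μ // N X ≤ 1} := ⟨⟨0, by simp⟩⟩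
  let q (F : ConvAlg G μ) : ℝ := ⨆ X : {X : ConvAlg G μ // N X ≤ 1}, N (F * X)
  have hI (F : ConvAlg G μ) : 0 ≤ ∫ x, ‖F x‖ ∂μ := integral_nonneg fun x => norm_nonneg _
  have hle (F : ConvAlg G μ) (X : {X : ConvAlg G μ // N X ≤ 1}) :
      N (F * X) ≤ ∫ x, ‖F x‖ ∂μ :=
    (hL F X).trans (mul_le_of_le_one_right (hI F) X.2)
  have hbdd (F : ConvAlg G μ) :
      BddAbove (Set.range fun X : {X : ConvAlg G μ // N X ≤ 1} => N (F * X)) :=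
    ⟨_, by rintro _ ⟨X, rfl⟩; exact hle F X⟩
  have q_nonneg (F : ConvAlg G μ) : 0 ≤ q F := Real.iSup_nonneg fun X => apply_nonneg _ _
  have le_q (F X : ConvAlg G μ) : N (F * X) ≤ q F * N X := by
    rcases (apply_nonneg N X).eq_or_lt with h | h
    · rw [← h, mul_zero]
      simpa [← h] using hL F X
    · have h1 : N (((N X)⁻¹ : ℂ) • X) ≤ 1 := by
        rw [map_smul_eq_mul, norm_inv, Complex.norm_real, Real.norm_of_nonneg h.le,
          inv_mul_cancel₀ h.ne']
      have h2 := le_ciSup (hbdd F) ⟨_, h1⟩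
      change N (F * (((N X)⁻¹ : ℂ) • X)) ≤ q F at h2
      rw [mul_smul_comm, map_smul_eq_mul, norm_inv, Complex.norm_real, Real.norm_of_nonneg h.le,
        inv_mul_eq_div, div_le_iff₀ h] at h2
      exact h2
  have q_mul (F K : ConvAlg G μ) : q (F * K) ≤ q F * q K := ciSup_le fun X => by
    rw [mul_assoc]
    refine (le_q F _).trans (mul_le_mul_of_nonneg_left ?_ (q_nonneg F))
    exact le_ciSup (hbdd K) X
  have q_sq (F : ConvAlg G μ) : q F ^ 2 ≤ q (star F * F) := by
    refine (Real.le_sqrt (q_nonneg F) (q_nonneg _)).1 (ciSup_le fun X => Real.le_sqrt_of_sq_le ?_)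
    refine (hN F X).trans ((mul_le_of_le_one_left (apply_nonneg _ _) X.2).trans ?_)
    exact le_ciSup (hbdd (star F * F)) X
  have q_star (F : ConvAlg G μ) : q (star F) ≤ q F := by
    rcases (q_nonneg (star F)).eq_or_lt with h | h
    · rw [← h]; exact q_nonneg F
    · have h2 := (q_sq (star F)).trans (q_mul _ _)
      rw [star_star, sq] at h2
      exact le_of_mul_le_mul_right h2 h
  let p : Seminorm ℂ (ConvAlg G μ) := Seminorm.ofSMulLE q
    (le_antisymm (ciSup_le fun X => by simp) (q_nonneg 0))
    (fun F K => ciSup_le fun X => by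
      rw [add_mul]
      exact (map_add_le_add N _ _).trans (add_le_add (le_ciSup (hbdd F) X) (le_ciSup (hbdd K) X)))
    (fun c F => ciSup_le fun X => by
      rw [smul_mul_assoc, map_smul_eq_mul]
      exact mul_le_mul_of_nonneg_left (le_ciSup (hbdd F) X) (norm_nonneg c))
  have hp : IsCStarSeminorm p :=
    { mul_le := q_mul
      star_mul_self := fun F => by
        refine le_antisymm ((q_mul _ _).trans ?_) (q_sq F)
        rw [sq]
        exact mul_le_mul_of_nonneg_right (q_star F) (q_nonneg F)
      le_L1 := fun F => ciSup_le fun X => hle F X }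
  exact (le_q F X).trans (mul_le_mul_of_nonneg_right (le_maxNorm hp F) (apply_nonneg _ _))

end OperatorSeminorm

section Inner

open FullGroupCStar

variable {H G : Type*}
  [TopologicalSpace H] [Group H] [IsTopologicalGroup H] [LocallyCompactSpace H]
  [MeasurableSpace H] [BorelSpace H]
  [TopologicalSpace G] [Group G] [IsTopologicalGroup G] [LocallyCompactSpace G]
  [MeasurableSpace G] [BorelSpace G] {φ : H →* G}
  {μH : Measure H} [μH.IsHaarMeasure] {μG : Measure G} [μG.IsHaarMeasure]

theorem restrict_star (hφ : IsOpenEmbedding φ) (hH : ∀ h : H, Measure.modularCharacter h = 1)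
    (hG : ∀ g : G, Measure.modularCharacter g = 1) (F : ConvAlg G μG) :
    (restrict hφ (star F) : ConvAlg H μH) = star (restrict hφ F) := by
  apply ext; intro y
  rw [star_apply_of_unimodular hH, restrict_apply, restrict_apply, star_apply_of_unimodular hG,
    map_inv φ]
  simp

theorem extend_injective (hφ : IsOpenEmbedding φ) :
    Function.Injective (extend hφ : ConvAlg H μH →ₗ[ℂ] ConvAlg G μG) :=
  Function.LeftInverse.injective (g := restrict hφ) (restrict_extend hφ)

/-- Translation by an element `l` of `H` is unitary on `C_c(H)`. The identity is checked after
extension to `G`, where the translations by `φ l` commute with convolution by centrality. -/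
theorem star_translate_mul (hφ : IsOpenEmbedding φ) (hc : φ.range ≤ Subgroup.center G)
    (hH : ∀ h : H, Measure.modularCharacter h = 1) (hG : ∀ g : G, Measure.modularCharacter g = 1)
    (μG : Measure G) [μG.IsHaarMeasure] (l : H) (a b : ConvAlg H μH) :
    star (translate l⁻¹ a) * b = star a * translate l b := by
  apply extend_injective (μG := μG) hφ
  rw [extend_mul, extend_star hφ hH hG, extend_translate, star_translate_extend hφ hc hH hG,
    extend_mul, extend_translate, extend_mul_translate hφ hc, map_inv, inv_inv, translate_conv]

/-- The `C*(H)`-valued inner product on `C_c(G)`: the restriction of `X* * Y` to the subgroup. -/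
noncomputable def innerProd (hφ : IsOpenEmbedding φ) (μH : Measure H) [μH.IsHaarMeasure]
    (X Y : ConvAlg G μG) : FullGroupCStar H μH :=
  of (restrict hφ (star X * Y))

/-- The inner product is the orthogonal sum of the canonical inner products of the components on
the cosets; this makes it positive. -/
theorem innerProd_eq_sum (hφ : IsOpenEmbedding φ) (hc : φ.range ≤ Subgroup.center G)
    (hH : ∀ h : H, Measure.modularCharacter h = 1) (hG : ∀ g : G, Measure.modularCharacter g = 1)
    (X Y : ConvAlg G μG) {s : Finset (G ⧸ φ.range)}
    (hs : ∀ q : G ⧸ φ.range, (component hφ q.out Y : ConvAlg H μH) ≠ 0 → q ∈ s) :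
    innerProd hφ μH X Y =
      ∑ q ∈ s, star (of (component hφ q.out X)) * of (component hφ q.out Y) := by
  let W (g : G) : ConvAlg H μH →ₗ[ℂ] FullGroupCStar H μH :=
    (LinearMap.mulLeft ℂ (star (of (component hφ g X)))).comp
      ((ofHom : ConvAlg H μH →⋆ₙₐ[ℂ] _) : ConvAlg H μH →ₗ[ℂ] FullGroupCStar H μH)
  have hWa (g : G) (f : ConvAlg H μH) : W g f = of (star (component hφ g X) * f) := by
    rw [of_mul, of_star]; rfl
  have hW : ∀ g l f, W (g * φ l) f = W g (translate l f) := by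
    intro g l f
    rw [hWa, hWa, component_mul_map, star_translate_mul hφ hc hH hG μG]
  have key (Y : ConvAlg G μG) : innerProd hφ μH X Y = cosetSum hφ W Y := by
    induction Y using induction_translate_extend (μH := μH) (μG := μG) hφ with
    | zero => simp [innerProd, of_zero]
    | add F F' h h' => rw [innerProd, mul_add, map_add, of_add, map_add, ← h, ← h']; rfl
    | translate_extend g f =>
      have h1 : star X * translate g (extend hφ f) =
          star (translate g⁻¹ (extend hφ (star f) * X)) := by
        rw [← translate_conv, star_mul, star_translate_extend hφ hc hH hG, inv_inv, star_star]
      rw [cosetSum_translate_extend hφ W hW, hWa, innerProd, h1, ← extend_mul_translate hφ hc,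
        restrict_star hφ hH hG, restrict_extend_mul, star_mul, star_star, component_apply]
  rw [key, cosetSum_apply hφ W Y hs]
  simp only [hWa, of_mul, of_star]

theorem innerProd_mul_left (hφ : IsOpenEmbedding φ) (F X Y : ConvAlg G μG) :
    innerProd hφ μH (F * X) Y = innerProd hφ μH X (star F * Y) := by
  rw [innerProd, innerProd, star_mul, mul_assoc]

open scoped InnerProductSpace in
/-- The `C*(H)`-valued inner product gives a seminorm on `C_c(G)` and satisfies the Cauchy–Schwarz
inequality, because finitely many components realise it as that of a free Hilbert module. -/
theorem exists_seminorm_innerProd (hφ : IsOpenEmbedding φ) (hc : φ.range ≤ Subgroup.center G)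
    (hH : ∀ h : H, Measure.modularCharacter h = 1) (hG : ∀ g : G, Measure.modularCharacter g = 1)
    (μH : Measure H) [μH.IsHaarMeasure] (μG : Measure G) [μG.IsHaarMeasure] :
    ∃ N : Seminorm ℂ (ConvAlg G μG), (∀ X, N X = √‖innerProd hφ μH X X‖) ∧
      ∀ X Y, ‖innerProd hφ μH X Y‖ ≤ N X * N Y := by
  classical
  let A := FullGroupCStar H μH
  let _ := CStarAlgebra.spectralOrder A
  have := CStarAlgebra.spectralOrderedRing A
  -- The vector of adjoints of the components: the inner product of Mathlib's Hilbert module `A`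
  -- is `⟪x, y⟫ = y * star x`.
  let v (s : Finset (G ⧸ φ.range)) (X : ConvAlg G μG) : WithCStarModule A (s → A) :=
    (WithCStarModule.equiv A (s → A)).symm fun q => star (of (component hφ q.1.out X))
  have v_add (s X Y) : v s (X + Y) = v s X + v s Y := by
    refine WithCStarModule.ext fun q => ?_
    change star (of (component hφ q.1.out (X + Y))) = star (of _) + star (of _)
    rw [map_add, of_add, star_add]
  have hv (s X Y)
      (hs : ∀ q : G ⧸ φ.range, (component hφ q.out Y : ConvAlg H μH) ≠ 0 → q ∈ s) :
      innerProd hφ μH X Y = ⟪v s Y, v s X⟫_A := by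
    rw [innerProd_eq_sum hφ hc hH hG X Y hs, WithCStarModule.pi_inner, ← Finset.sum_coe_sort]
    refine Finset.sum_congr rfl fun q _ => ?_
    change _ = star (of _) * star (star (of _))
    rw [star_star]
  have hnorm (s X)
      (hs : ∀ q : G ⧸ φ.range, (component hφ q.out X : ConvAlg H μH) ≠ 0 → q ∈ s) :
      √‖innerProd hφ μH X X‖ = ‖v s X‖ := by
    rw [hv s X X hs, ← CStarModule.norm_eq_sqrt_norm_inner_self]
  let S (X : ConvAlg G μG) := (finite_component_ne_zero (μH := μH) hφ X).toFinset
  have hS (X : ConvAlg G μG) (q : G ⧸ φ.range)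
      (hq : (component hφ q.out X : ConvAlg H μH) ≠ 0) : q ∈ S X := by simpa [S] using hq
  have hadd (X Y : ConvAlg G μG) : √‖innerProd hφ μH (X + Y) (X + Y)‖ ≤
      √‖innerProd hφ μH X X‖ + √‖innerProd hφ μH Y Y‖ := by
    let s := S X ∪ S Y
    have hX := fun q hq => Finset.mem_union_left (S Y) (hS X q hq)
    have hY := fun q hq => Finset.mem_union_right (S X) (hS Y q hq)
    rw [hnorm s _ hX, hnorm s _ hY, hnorm s, v_add]
    · exact norm_add_le _ _
    · intro q hq
      by_cases h : (component hφ q.out X : ConvAlg H μH) = 0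
      · refine hY q ?_
        rwa [map_add, h, zero_add] at hq
      · exact hX q h
  have hsmul (c : ℂ) (X : ConvAlg G μG) : √‖innerProd hφ μH (c • X) (c • X)‖ =
      ‖c‖ * √‖innerProd hφ μH X X‖ := by
    have : innerProd hφ μH (c • X) (c • X) = (star c * c) • innerProd hφ μH X X := by
      rw [innerProd, star_smul, smul_mul_assoc, mul_smul_comm, smul_smul, map_smul, of_smul]; rfl
    rw [this, norm_smul, norm_mul, norm_star, Real.sqrt_mul (mul_self_nonneg _),
      Real.sqrt_mul_self (norm_nonneg c)]
  refine ⟨Seminorm.of _ hadd hsmul, fun X => rfl, fun X Y => ?_⟩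
  change _ ≤ √‖innerProd hφ μH X X‖ * √‖innerProd hφ μH Y Y‖
  let s := S X ∪ S Y
  have hX := fun q hq => Finset.mem_union_left (S Y) (hS X q hq)
  have hY := fun q hq => Finset.mem_union_right (S X) (hS Y q hq)
  rw [hnorm s _ hX, hnorm s _ hY, hv s _ _ hY, mul_comm]
  exact CStarModule.norm_inner_le _

/-- Left multiplication by `f ∈ C_c(H)` acts diagonally on the components. -/
theorem norm_innerProd_extend_mul_le (hφ : IsOpenEmbedding φ)
    (hc : φ.range ≤ Subgroup.center G)
    (hH : ∀ h : H, Measure.modularCharacter h = 1) (hG : ∀ g : G, Measure.modularCharacter g = 1)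
    (f : ConvAlg H μH) (X : ConvAlg G μG) :
    ‖innerProd hφ μH (extend hφ f * X) (extend hφ f * X)‖ ≤
      ‖f‖ ^ 2 * ‖innerProd hφ μH X X‖ := by
  let _ := CStarAlgebra.spectralOrder (FullGroupCStar H μH)
  have := CStarAlgebra.spectralOrderedRing (FullGroupCStar H μH)
  have hcomp (g : G) : (component hφ g (extend hφ f * X) : ConvAlg H μH) =
      f * component hφ g X := by
    rw [component_apply, ← extend_mul_translate hφ hc, restrict_extend_mul, component_apply]
  let s := (finite_component_ne_zero (μH := μH) hφ X).toFinset
  have hs (q : G ⧸ φ.range) (hq : (component hφ q.out X : ConvAlg H μH) ≠ 0) : q ∈ s := by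
    simpa [s] using hq
  rw [innerProd_eq_sum hφ hc hH hG X X hs, innerProd_eq_sum hφ hc hH hG _ _ (s := s)]
  · simp only [hcomp]
    have hb : ‖star (of f) * of f‖ = ‖f‖ ^ 2 := by
      rw [CStarRing.norm_star_mul_self, norm_of, sq]
    have hterm (q : G ⧸ φ.range) : star (of (f * component hφ q.out X)) *
        of (f * component hφ q.out X) ≤
        ‖f‖ ^ 2 • (star (of (component hφ q.out X)) * of (component hφ q.out X)) := by
      have h := CStarAlgebra.star_left_conjugate_le_norm_smul
        (a := of (component hφ q.out X)) (b := star (of f) * of f) (.star_mul_self (of f))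
      rw [hb] at h
      rw [of_mul, star_mul]
      simpa only [mul_assoc] using h
    refine (CStarAlgebra.norm_le_norm_of_nonneg_of_le
      (Finset.sum_nonneg fun q _ => star_mul_self_nonneg _)
      (Finset.sum_le_sum fun q _ => hterm q)).trans ?_
    rw [← Finset.smul_sum, norm_smul, Real.norm_of_nonneg (sq_nonneg _)]
  · intro q hq
    refine hs q fun h => hq ?_
    rw [hcomp, h, mul_zero]

/-- The C*-norm of `C_c(H)` does not decrease under extension by zero to a group in which `H` is
open and central: the action of `C_c(G)` on the completion of `C_c(G)` for the `C*(H)`-valued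
inner product, induced from the left regular action of `C*(H)`, is contractive for the C*-norm. -/
theorem norm_le_norm_extend (hφ : IsOpenEmbedding φ) (hc : φ.range ≤ Subgroup.center G)
    (hH : ∀ h : H, Measure.modularCharacter h = 1) (hG : ∀ g : G, Measure.modularCharacter g = 1)
    (f : ConvAlg H μH) : ‖f‖ ≤ ‖(extend hφ f : ConvAlg G μG)‖ := by
  obtain ⟨N, hN, hCS⟩ := exists_seminorm_innerProd hφ hc hH hG μH μG
  have hNsq (X : ConvAlg G μG) : N X ^ 2 = ‖innerProd hφ μH X X‖ := by
    rw [hN, Real.sq_sqrt (norm_nonneg _)]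
  have hadj (F X : ConvAlg G μG) : N (F * X) ^ 2 ≤ N X * N (star F * F * X) := by
    rw [hNsq, innerProd_mul_left, ← mul_assoc]
    exact hCS _ _
  have hT (g : G) (a : ConvAlg H μH) (X : ConvAlg G μG) :
      N (translate g (extend hφ a) * X) ≤ ‖a‖ * N X := by
    refine (pow_le_pow_iff_left₀ (apply_nonneg _ _)
      (mul_nonneg (norm_nonneg _) (apply_nonneg _ _)) two_ne_zero).1 ?_
    rw [mul_pow, hNsq, hNsq]
    refine le_of_eq_of_le ?_ (norm_innerProd_extend_mul_le hφ hc hH hG a X)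
    rw [innerProd_mul_left, ← mul_assoc, star_translate_extend_mul_self hφ hc hH hG, extend_mul,
      extend_star hφ hH hG, mul_assoc, ← innerProd_mul_left]
  have hL (F X : ConvAlg G μG) : N (F * X) ≤ (∫ x, ‖F x‖ ∂μG) * N X := by
    let s := (finite_component_ne_zero (μH := μH) hφ F).toFinset
    calc N (F * X) = N (∑ q ∈ s,
          translate q.out (extend hφ (component hφ q.out F : ConvAlg H μH)) * X) := by
          rw [← Finset.sum_mul, sum_translate_extend_component]
      _ ≤ ∑ q ∈ s, (∫ y, ‖(component hφ q.out F : ConvAlg H μH) y‖ ∂μH) * N X :=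
          (Finset.le_sum_of_subadditive N (map_zero N).le (map_add_le_add N) s _).trans
            (Finset.sum_le_sum fun q _ => (hT _ _ _).trans
              (mul_le_mul_of_nonneg_right (norm_le_L1 _) (apply_nonneg _ _)))
      _ ≤ _ := by
          rw [← Finset.sum_mul]
          exact mul_le_mul_of_nonneg_right (sum_integral_norm_component_le hφ F s)
            (apply_nonneg _ _)
  have hNE (g : ConvAlg H μH) : N (extend hφ g) = ‖g‖ := by
    rw [hN, innerProd, ← extend_star hφ hH hG, ← extend_mul, restrict_extend, of_mul, of_star,
      CStarRing.norm_star_mul_self, Real.sqrt_mul_self (norm_nonneg _), norm_of]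
  have h := mul_le_norm_mul N hadj hL (extend hφ f) (extend hφ (star f))
  rw [← extend_mul, hNE, hNE, norm_star_conv] at h
  have h2 : ‖f * star f‖ = ‖f‖ * ‖f‖ := by
    rw [← norm_of, of_mul, of_star, CStarRing.norm_self_mul_star, norm_of]
  rw [h2] at h
  rcases (norm_nonneg f).eq_or_lt with h0 | h0
  · rw [← h0]; exact norm_nonneg _
  · exact le_of_mul_le_mul_right h h0

theorem injective_induced (hφ : IsOpenEmbedding φ) (hc : φ.range ≤ Subgroup.center G)
    (hH : ∀ h : H, Measure.modularCharacter h = 1) (hG : ∀ g : G, Measure.modularCharacter g = 1) :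
    Function.Injective
      (induced hφ hH hG : FullGroupCStar H μH →⋆ₙₐ[ℂ] FullGroupCStar G μG) := by
  refine (injective_iff_map_eq_zero _).2 fun a ha => ?_
  have h : ‖a‖ ≤ ‖(induced hφ hH hG a : FullGroupCStar G μG)‖ := by
    clear ha
    induction a using induction_on with
    | hP => exact isClosed_le continuous_norm (continuous_hom _).norm
    | h f =>
      rw [induced_of, norm_of, norm_of]
      exact norm_le_norm_extend hφ hc hH hG f
  rwa [ha, norm_zero, norm_le_zero_iff] at h

end Inner

end ConvAlg

/-! ### The group action attached to a *-homomorphism -/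

namespace FullGroupCStar

open ConvAlg
open scoped TensorProduct

section Essential

variable {H : Type*}
  [TopologicalSpace H] [Group H] [IsTopologicalGroup H] [LocallyCompactSpace H]
  [MeasurableSpace H] [BorelSpace H] {μH : Measure H} [μH.IsHaarMeasure]
  {D : Type*} [NonUnitalCStarAlgebra D] (ψ₀ : FullGroupCStar H μH →⋆ₙₐ[ℂ] D)

/-- The linear map `f ⊗ d ↦ θ f * d` on `C_c(H) ⊗ D` given by a linear map `θ : C_c(H) → D`. -/
noncomputable def tensorMul (θ : ConvAlg H μH →ₗ[ℂ] D) : ConvAlg H μH ⊗[ℂ] D →ₗ[ℂ] D :=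
  TensorProduct.lift ((LinearMap.mul ℂ D).comp θ)

theorem tensorMul_tmul (θ : ConvAlg H μH →ₗ[ℂ] D) (f : ConvAlg H μH) (d : D) :
    tensorMul θ (f ⊗ₜ d) = θ f * d := rfl

/-- The restriction of `ψ₀` to `C_c(H)`. -/
noncomputable def coeff : ConvAlg H μH →ₗ[ℂ] D :=
  ((ψ₀.comp ofHom : ConvAlg H μH →⋆ₙₐ[ℂ] D) : ConvAlg H μH →ₗ[ℂ] D)

theorem coeff_apply (f : ConvAlg H μH) : coeff ψ₀ f = ψ₀ (of f) := rfl

/-- The essential subspace of `ψ₀`: the closed right ideal of `D` generated by its image. -/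
noncomputable def essential : Submodule ℂ D :=
  (LinearMap.range (tensorMul (coeff ψ₀))).topologicalClosure

theorem isClosed_essential : IsClosed (essential ψ₀ : Set D) :=
  Submodule.isClosed_topologicalClosure _

theorem mul_mem_essential (f : ConvAlg H μH) (d : D) : ψ₀ (of f) * d ∈ essential ψ₀ :=
  Submodule.le_topologicalClosure _ ⟨f ⊗ₜ d, rfl⟩

/-- The parametrization of a dense part of the essential subspace. -/
noncomputable def toEssential : ConvAlg H μH ⊗[ℂ] D →ₗ[ℂ] essential ψ₀ :=
  (tensorMul (coeff ψ₀)).codRestrict _ fun t => Submodule.le_topologicalClosure _ ⟨t, rfl⟩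

theorem denseRange_toEssential : DenseRange (toEssential ψ₀) := by
  intro x
  rw [closure_subtype]
  refine closure_mono ?_ x.2
  rintro _ ⟨t, rfl⟩
  exact ⟨toEssential ψ₀ t, ⟨t, rfl⟩, rfl⟩

variable {ψ₀}

theorem essential_induction {P : essential ψ₀ → Prop} (x : essential ψ₀)
    (closed : IsClosed {x | P x}) (add : ∀ x y, P x → P y → P (x + y))
    (mul : ∀ f d, P ⟨ψ₀ (of f) * d, mul_mem_essential ψ₀ f d⟩) : P x := by
  refine (denseRange_toEssential ψ₀).induction_on x closed fun t => ?_
  induction t using TensorProduct.induction_on with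
  | zero =>
    have h0 : toEssential ψ₀ 0 = ⟨ψ₀ (of 0) * 0, mul_mem_essential ψ₀ 0 0⟩ := by
      ext; simp
    rw [h0]; exact mul 0 0
  | tmul f d => exact mul f d
  | add t s ht hs => rw [map_add]; exact add _ _ ht hs

/-- A limit of elements `ψ₀ e * x` is in the essential subspace. -/
theorem mem_essential {x : D}
    (h : ∀ ε > 0, ∃ e : ConvAlg H μH, ‖ψ₀ (of e) * x - x‖ < ε) : x ∈ essential ψ₀ := by
  have hcl : x ∈ closure (essential ψ₀ : Set D) := by
    refine Metric.mem_closure_iff.2 fun ε hε => ?_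
    obtain ⟨e, he⟩ := h ε hε
    exact ⟨_, mul_mem_essential ψ₀ e x, by rwa [dist_comm, dist_eq_norm]⟩
  rwa [(isClosed_essential ψ₀).closure_eq] at hcl

theorem norm_apply_of_le (f : ConvAlg H μH) : ‖ψ₀ (of f)‖ ≤ ‖f‖ :=
  (NonUnitalStarAlgHom.norm_apply_le ψ₀ _).trans (norm_of f).le

theorem of_sub (f g : ConvAlg H μH) : of (f - g) = of f - of g := map_sub ofHom f g

theorem apply_of_mem_essential (f : ConvAlg H μH) : ψ₀ (of f) ∈ essential ψ₀ := by
  refine mem_essential fun ε hε => ?_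
  obtain ⟨e, he⟩ := exists_norm_mul_sub_lt f hε
  refine ⟨e, lt_of_le_of_lt ?_ he⟩
  rw [← map_mul, ← of_mul, ← map_sub, ← of_sub]
  exact norm_apply_of_le _

theorem mul_right_mem_essential {x : D} (hx : x ∈ essential ψ₀) (d : D) :
    x * d ∈ essential ψ₀ := by
  have hc : IsClosed {x : essential ψ₀ | (x : D) * d ∈ essential ψ₀} :=
    (isClosed_essential ψ₀).preimage (continuous_subtype_val.mul continuous_const)
  refine essential_induction (P := fun x => (x : D) * d ∈ essential ψ₀) ⟨x, hx⟩ hc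
    (fun x y h h' => ?_) fun f d' => ?_
  · rw [Submodule.coe_add, add_mul]; exact add_mem h h'
  · simp only [mul_assoc]; exact mul_mem_essential ψ₀ f _

/-- An element of the essential subspace is determined by its left multiples by the image of
`ψ₀`. -/
theorem essential_ext {x y : essential ψ₀}
    (h : ∀ e : ConvAlg H μH, ψ₀ (of e) * x = ψ₀ (of e) * y) : x = y := by
  have key (w : essential ψ₀) : star (w : D) * ((x - y : essential ψ₀) : D) = 0 := by
    induction w using essential_induction with
    | closed =>
      exact isClosed_eq (continuous_subtype_val.star.mul continuous_const) continuous_const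
    | add w w' hw hw' => rw [Submodule.coe_add, star_add, add_mul, hw, hw', add_zero]
    | mul f d =>
      have h' := h (star f)
      rw [of_star, map_star] at h'
      rw [star_mul, mul_assoc, Submodule.coe_sub, mul_sub, h', sub_self, mul_zero]
  have h0 := key (x - y)
  rw [CStarRing.star_mul_self_eq_zero_iff] at h0
  exact sub_eq_zero.1 (Subtype.ext h0)

end Essential

section Action

variable {H G : Type*}
  [TopologicalSpace H] [Group H] [IsTopologicalGroup H] [LocallyCompactSpace H]
  [MeasurableSpace H] [BorelSpace H]
  [TopologicalSpace G] [Group G] [IsTopologicalGroup G] [LocallyCompactSpace G]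
  [MeasurableSpace G] [BorelSpace G] {φ : H →* G}
  {μH : Measure H} [μH.IsHaarMeasure] {μG : Measure G} [μG.IsHaarMeasure]
  {D : Type*} [NonUnitalCStarAlgebra D]
  (hφ : IsOpenEmbedding φ) (hc : φ.range ≤ Subgroup.center G)
  (hH : ∀ h : H, Measure.modularCharacter h = 1) (hG : ∀ g : G, Measure.modularCharacter g = 1)
  (ψ₀ : FullGroupCStar H μH →⋆ₙₐ[ℂ] D) (ψ : FullGroupCStar G μG →⋆ₙₐ[ℂ] D)
  (hψ : ψ.comp (induced hφ hH hG) = ψ₀)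

/-- The linear map `f ↦ ψ (δ_g * f)` on `C_c(H)`. -/
noncomputable def translateCoeff (g : G) : ConvAlg H μH →ₗ[ℂ] D :=
  (coeff ψ).comp ((translate g).comp (extend hφ))

theorem translateCoeff_apply (g : G) (f : ConvAlg H μH) :
    translateCoeff hφ ψ g f = ψ (of (translate g (extend hφ f))) := rfl

include hψ in
theorem apply_of_extend (f : ConvAlg H μH) : ψ (of (extend hφ f)) = ψ₀ (of f) := by
  rw [← hψ, NonUnitalStarAlgHom.comp_apply, induced_of]

include hc in
theorem translateCoeff_mul (g h : G) (a b : ConvAlg H μH) :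
    translateCoeff hφ ψ g a * translateCoeff hφ ψ h b = translateCoeff hφ ψ (g * h) (a * b) := by
  simp only [translateCoeff_apply]
  rw [← map_mul, ← of_mul, translate_extend_mul hφ hc]

include hψ in
theorem translateCoeff_one (f : ConvAlg H μH) : translateCoeff hφ ψ 1 f = ψ₀ (of f) := by
  rw [translateCoeff_apply, translate_one, apply_of_extend hφ hH hG ψ₀ ψ hψ]

include hc hH hG in
theorem star_translateCoeff (g : G) (f : ConvAlg H μH) :
    star (translateCoeff hφ ψ g f) = translateCoeff hφ ψ g⁻¹ (star f) := by
  simp only [translateCoeff_apply]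
  rw [← map_star, ← of_star, star_translate_extend hφ hc hH hG]

include hψ hc in
theorem mul_translateCoeff (e : ConvAlg H μH) (g : G) (f : ConvAlg H μH) :
    ψ₀ (of e) * translateCoeff hφ ψ g f = translateCoeff hφ ψ g (e * f) := by
  rw [← translateCoeff_one hφ hH hG ψ₀ ψ hψ, translateCoeff_mul hφ hc, one_mul]

include hψ hc in
theorem translateCoeff_mul_apply (e : ConvAlg H μH) (g : G) (f : ConvAlg H μH) :
    translateCoeff hφ ψ g e * ψ₀ (of f) = translateCoeff hφ ψ g (e * f) := by
  rw [← translateCoeff_one hφ hH hG ψ₀ ψ hψ, translateCoeff_mul hφ hc, mul_one]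

include hψ hc in
theorem norm_translateCoeff_le (g : G) (f : ConvAlg H μH) :
    ‖translateCoeff hφ ψ g f‖ ≤ ‖f‖ := by
  refine (pow_le_pow_iff_left₀ (norm_nonneg _) (norm_nonneg _) two_ne_zero).1 ?_
  rw [sq, ← CStarRing.norm_star_mul_self, star_translateCoeff hφ hc hH hG, translateCoeff_mul hφ hc,
    inv_mul_cancel, translateCoeff_one hφ hH hG ψ₀ ψ hψ]
  refine (norm_apply_of_le _).trans ((norm_mul_le _ _).trans ?_)
  rw [norm_star_conv, sq]

include hψ hc in
theorem translateCoeff_mem_essential (g : G) (f : ConvAlg H μH) :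
    translateCoeff hφ ψ g f ∈ essential ψ₀ := by
  refine mem_essential fun ε hε => ?_
  obtain ⟨e, he⟩ := exists_norm_mul_sub_lt f hε
  refine ⟨e, lt_of_le_of_lt ?_ he⟩
  rw [mul_translateCoeff hφ hc hH hG ψ₀ ψ hψ, ← map_sub]
  exact norm_translateCoeff_le hφ hc hH hG ψ₀ ψ hψ _ _

include hψ hc in
theorem tensorMul_translateCoeff_mem (g : G) (t : ConvAlg H μH ⊗[ℂ] D) :
    tensorMul (translateCoeff hφ ψ g) t ∈ essential ψ₀ := by
  induction t using TensorProduct.induction_on with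
  | zero => rw [map_zero]; exact zero_mem _
  | tmul f d =>
    rw [tensorMul_tmul]
    exact mul_right_mem_essential (translateCoeff_mem_essential hφ hc hH hG ψ₀ ψ hψ g f) d
  | add t s ht hs => rw [map_add]; exact add_mem ht hs

include hψ hc in
theorem star_tensorMul_translateCoeff (g : G) (t s : ConvAlg H μH ⊗[ℂ] D) :
    star (tensorMul (translateCoeff hφ ψ g) t) * tensorMul (translateCoeff hφ ψ g) s =
      star (tensorMul (coeff ψ₀) t) * tensorMul (coeff ψ₀) s := by
  induction t using TensorProduct.induction_on with
  | zero => simp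
  | add t t' ht ht' => rw [map_add, map_add, star_add, star_add, add_mul, add_mul, ht, ht']
  | tmul f d =>
    induction s using TensorProduct.induction_on with
    | zero => simp
    | add t t' ht ht' => rw [map_add, map_add, mul_add, mul_add, ht, ht']
    | tmul f' d' =>
      simp only [tensorMul_tmul, star_mul, coeff_apply]
      rw [mul_assoc, ← mul_assoc (star _) _ d', star_translateCoeff hφ hc hH hG,
        translateCoeff_mul hφ hc, inv_mul_cancel, translateCoeff_one hφ hH hG ψ₀ ψ hψ, of_mul,
        map_mul, of_star, map_star]
      simp only [mul_assoc]

/-- The action of `g` on the essential subspace, `ψ₀ f * d ↦ ψ (δ_g * f) * d`. -/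
noncomputable def action (g : G) : essential ψ₀ →L[ℂ] essential ψ₀ :=
  haveI : CompleteSpace (essential ψ₀) := (isClosed_essential ψ₀).completeSpace_coe
  ((tensorMul (translateCoeff hφ ψ g)).codRestrict (essential ψ₀)
    (tensorMul_translateCoeff_mem hφ hc hH hG ψ₀ ψ hψ g)).extendOfNorm (toEssential ψ₀)

theorem coe_action_mul (g : G) (f : ConvAlg H μH) (d : D) :
    (action hφ hc hH hG ψ₀ ψ hψ g ⟨ψ₀ (of f) * d, mul_mem_essential ψ₀ f d⟩ : D) =
      translateCoeff hφ ψ g f * d := by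
  have : CompleteSpace (essential ψ₀) := (isClosed_essential ψ₀).completeSpace_coe
  refine congrArg Subtype.val (LinearMap.extendOfNorm_eq (denseRange_toEssential ψ₀) ⟨1, ?_⟩
    (f ⊗ₜ[ℂ] d))
  intro t
  rw [one_mul]
  refine (pow_le_pow_iff_left₀ (norm_nonneg _) (norm_nonneg _) two_ne_zero).1 ?_
  change ‖tensorMul (translateCoeff hφ ψ g) t‖ ^ 2 ≤ ‖tensorMul (coeff ψ₀) t‖ ^ 2
  rw [sq, sq, ← CStarRing.norm_star_mul_self, ← CStarRing.norm_star_mul_self,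
    star_tensorMul_translateCoeff hφ hc hH hG ψ₀ ψ hψ]

/-- The action is the one of a multiplier of the algebra. -/
theorem translateCoeff_mul_action (g h : G) (e : ConvAlg H μH) (y : essential ψ₀) :
    translateCoeff hφ ψ g e * (action hφ hc hH hG ψ₀ ψ hψ h y : D) =
      translateCoeff hφ ψ (g * h) e * (y : D) := by
  induction y using essential_induction with
  | closed =>
    exact isClosed_eq (continuous_const.mul (continuous_subtype_val.comp
      (action hφ hc hH hG ψ₀ ψ hψ h).continuous)) (continuous_const.mul continuous_subtype_val)
  | add y y' hy hy' => rw [map_add, Submodule.coe_add, Submodule.coe_add, mul_add, mul_add, hy, hy']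
  | mul f d =>
    rw [coe_action_mul, ← mul_assoc, ← mul_assoc, translateCoeff_mul hφ hc,
      translateCoeff_mul_apply hφ hc hH hG ψ₀ ψ hψ]

theorem mul_action (h : G) (e : ConvAlg H μH) (y : essential ψ₀) :
    ψ₀ (of e) * (action hφ hc hH hG ψ₀ ψ hψ h y : D) = translateCoeff hφ ψ h e * (y : D) := by
  rw [← translateCoeff_one hφ hH hG ψ₀ ψ hψ, translateCoeff_mul_action, one_mul]

/-- The action as a homomorphism from the group. -/
noncomputable def actionHom : G →* (essential ψ₀ →L[ℂ] essential ψ₀) where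
  toFun := action hφ hc hH hG ψ₀ ψ hψ
  map_one' := by
    ext1 y
    refine essential_ext fun e => ?_
    rw [mul_action, translateCoeff_one hφ hH hG ψ₀ ψ hψ]; rfl
  map_mul' g h := by
    ext1 y
    refine essential_ext fun e => ?_
    rw [mul_apply_eq_comp, mul_action, mul_action, translateCoeff_mul_action]

theorem coe_action_apply_of (g : G) (f : ConvAlg H μH) :
    (action hφ hc hH hG ψ₀ ψ hψ g ⟨ψ₀ (of f), apply_of_mem_essential f⟩ : D) =
      translateCoeff hφ ψ g f := by
  refine congrArg Subtype.val (a₂ := ⟨_, translateCoeff_mem_essential hφ hc hH hG ψ₀ ψ hψ g f⟩)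
    (essential_ext fun e => ?_)
  rw [mul_action, mul_translateCoeff hφ hc hH hG ψ₀ ψ hψ,
    translateCoeff_mul_apply hφ hc hH hG ψ₀ ψ hψ]

/-- On the subgroup `H` the action depends on `ψ₀` only. -/
theorem mul_action_map (l : H) (e : ConvAlg H μH) (y : essential ψ₀) :
    ψ₀ (of e) * (action hφ hc hH hG ψ₀ ψ hψ (φ l) y : D) = ψ₀ (of (translate l e)) * (y : D) := by
  rw [mul_action, translateCoeff_apply, ← extend_translate, apply_of_extend hφ hH hG ψ₀ ψ hψ]

theorem action_map_apply_of (l : H) (f : ConvAlg H μH) :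
    action hφ hc hH hG ψ₀ ψ hψ (φ l) ⟨ψ₀ (of f), apply_of_mem_essential f⟩ =
      ⟨ψ₀ (of (translate l f)), apply_of_mem_essential _⟩ := by
  ext
  rw [coe_action_apply_of, translateCoeff_apply, ← extend_translate,
    apply_of_extend hφ hH hG ψ₀ ψ hψ]

/-- The condition that `γ` acts on the essential subspace, by a family of operators `U`, as a
unitary of the right Hilbert `D`-module with adjoint `U γ⁻¹`, commuting with the image of `ψ₀`. -/
structure IsCovariant {Γ : Type*} [Group Γ] (U : Γ → (essential ψ₀ →L[ℂ] essential ψ₀))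
    (γ : Γ) : Prop where
  star_mul : ∀ x y : essential ψ₀, star (U γ x : D) * y = star (x : D) * U γ⁻¹ y
  mul_right : ∀ (x : essential ψ₀) (d : D),
    (U γ ⟨x * d, mul_right_mem_essential x.2 d⟩ : D) = U γ x * d
  mul_left : ∀ (e : ConvAlg H μH) (x : essential ψ₀),
    (U γ ⟨ψ₀ (of e) * x, mul_mem_essential ψ₀ e x⟩ : D) = ψ₀ (of e) * U γ x

theorem IsCovariant.mul {ψ₀ : FullGroupCStar H μH →⋆ₙₐ[ℂ] D} {Γ : Type*} [Group Γ]
    {U : Γ →* (essential ψ₀ →L[ℂ] essential ψ₀)} {γ δ : Γ}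
    (hγ : IsCovariant ψ₀ U γ) (hδ : IsCovariant ψ₀ U δ) : IsCovariant ψ₀ U (γ * δ) where
  star_mul x y := by
    rw [mul_inv_rev, map_mul, map_mul, mul_apply_eq_comp, mul_apply_eq_comp, hγ.star_mul,
      hδ.star_mul]
  mul_right x d := by
    rw [map_mul, mul_apply_eq_comp, mul_apply_eq_comp, ← hγ.mul_right]
    exact congrArg (fun z => (U γ z : D)) (Subtype.ext (hδ.mul_right x d))
  mul_left e x := by
    rw [map_mul, mul_apply_eq_comp, mul_apply_eq_comp, ← hγ.mul_left]
    exact congrArg (fun z => (U γ z : D)) (Subtype.ext (hδ.mul_left e x))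

theorem isCovariant_action (g : G) : IsCovariant ψ₀ (action hφ hc hH hG ψ₀ ψ hψ) g where
  star_mul x y := by
    induction x using essential_induction with
    | closed =>
      exact isClosed_eq ((continuous_subtype_val.comp
        (action hφ hc hH hG ψ₀ ψ hψ g).continuous).star.mul continuous_const)
        (continuous_subtype_val.star.mul continuous_const)
    | add x x' hx hx' =>
      rw [map_add, Submodule.coe_add, Submodule.coe_add, star_add, star_add, add_mul, add_mul,
        hx, hx']
    | mul f d =>
      rw [coe_action_mul, StarMul.star_mul, StarMul.star_mul, mul_assoc, mul_assoc,
        star_translateCoeff hφ hc hH hG, ← map_star, ← of_star, mul_action]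
  mul_right x d := by
    refine congrArg Subtype.val
      (a₂ := ⟨_, mul_right_mem_essential (action hφ hc hH hG ψ₀ ψ hψ g x).2 d⟩)
      (essential_ext fun e => ?_)
    rw [mul_action, ← mul_assoc, ← mul_assoc, mul_action]
  mul_left e x := by
    refine congrArg Subtype.val
      (a₂ := ⟨_, mul_mem_essential ψ₀ e (action hφ hc hH hG ψ₀ ψ hψ g x : D)⟩)
      (essential_ext fun e' => ?_)
    rw [mul_action, ← mul_assoc, translateCoeff_mul_apply hφ hc hH hG ψ₀ ψ hψ, ← mul_action,
      of_mul, map_mul, mul_assoc]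

end Action

section Integrated

variable {H Γ : Type*}
  [TopologicalSpace H] [Group H] [IsTopologicalGroup H] [LocallyCompactSpace H]
  [MeasurableSpace H] [BorelSpace H]
  [TopologicalSpace Γ] [Group Γ] [IsTopologicalGroup Γ] [LocallyCompactSpace Γ]
  [MeasurableSpace Γ] [BorelSpace Γ] {j : H →* Γ}
  {μH : Measure H} [μH.IsHaarMeasure] {μ : Measure Γ} [μ.IsHaarMeasure]
  {D : Type*} [NonUnitalCStarAlgebra D] {ψ₀ : FullGroupCStar H μH →⋆ₙₐ[ℂ] D}

/-- The coefficient of the integrated form of `U` on a coset: `f ↦ U γ (ψ₀ f)`. -/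
noncomputable def cosetCoeff (U : Γ → (essential ψ₀ →L[ℂ] essential ψ₀)) (γ : Γ) :
    ConvAlg H μH →ₗ[ℂ] D :=
  (essential ψ₀).subtype.comp ((U γ : essential ψ₀ →ₗ[ℂ] essential ψ₀).comp
    ((coeff ψ₀).codRestrict (essential ψ₀) apply_of_mem_essential))

theorem cosetCoeff_apply (U : Γ → (essential ψ₀ →L[ℂ] essential ψ₀)) (γ : Γ) (f : ConvAlg H μH) :
    cosetCoeff U γ f = U γ ⟨ψ₀ (of f), apply_of_mem_essential f⟩ := rfl

variable (U : Γ →* (essential ψ₀ →L[ℂ] essential ψ₀)) (hU : ∀ γ, IsCovariant ψ₀ U γ)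

include hU in
theorem cosetCoeff_mul (γ δ : Γ) (a b : ConvAlg H μH) :
    cosetCoeff U (γ * δ) (a * b) = cosetCoeff U γ a * cosetCoeff U δ b := by
  have h1 : (⟨ψ₀ (of (a * b)), apply_of_mem_essential _⟩ : essential ψ₀) =
      ⟨ψ₀ (of a) * (⟨ψ₀ (of b), apply_of_mem_essential b⟩ : essential ψ₀),
        mul_mem_essential ψ₀ a _⟩ := by
    ext; exact (congrArg ψ₀ (of_mul a b)).trans (map_mul ψ₀ _ _)
  have h2 : U δ ⟨ψ₀ (of a) * (⟨ψ₀ (of b), apply_of_mem_essential b⟩ : essential ψ₀),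
        mul_mem_essential ψ₀ a _⟩ =
      ⟨(⟨ψ₀ (of a), apply_of_mem_essential a⟩ : essential ψ₀) * cosetCoeff U δ b,
        mul_mem_essential ψ₀ a _⟩ := Subtype.ext ((hU δ).mul_left a _)
  rw [cosetCoeff_apply, map_mul, mul_apply_eq_comp, h1, h2]
  exact (hU γ).mul_right _ _

include hU in
theorem norm_apply_of_isCovariant (γ : Γ) (x : essential ψ₀) : ‖U γ x‖ = ‖x‖ := by
  refine (pow_left_inj₀ (norm_nonneg _) (norm_nonneg _) two_ne_zero).1 ?_
  change ‖(U γ x : D)‖ ^ 2 = ‖(x : D)‖ ^ 2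
  rw [sq, sq, ← CStarRing.norm_star_mul_self, (hU γ).star_mul, ← mul_apply_eq_comp, ← map_mul,
    inv_mul_cancel, map_one, ← CStarRing.norm_star_mul_self]
  rfl

include hU in
theorem norm_cosetCoeff_le (γ : Γ) (f : ConvAlg H μH) : ‖cosetCoeff U γ f‖ ≤ ‖f‖ := by
  exact (norm_apply_of_isCovariant U hU γ _).le.trans (norm_apply_of_le f)

theorem exists_norm_mul_sub_lt' (f : ConvAlg H μH) {ε : ℝ} (hε : 0 < ε) :
    ∃ e : ConvAlg H μH, ‖f * e - f‖ < ε := by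
  obtain ⟨e, he⟩ := exists_norm_mul_sub_lt (star f) hε
  refine ⟨star e, ?_⟩
  rwa [← norm_star_conv, star_sub, star_mul, star_star]

include hU in
theorem star_cosetCoeff_mem_essential (γ : Γ) (f : ConvAlg H μH) :
    star (cosetCoeff U γ f) ∈ essential ψ₀ := by
  refine mem_essential fun ε hε => ?_
  obtain ⟨e, he⟩ := exists_norm_mul_sub_lt' f hε
  refine ⟨star e, lt_of_le_of_lt ?_ he⟩
  have h1 : cosetCoeff U 1 e = ψ₀ (of e) := by rw [cosetCoeff_apply, map_one]; rfl
  rw [of_star, map_star, ← h1, ← star_mul, ← cosetCoeff_mul U hU, mul_one, ← star_sub, norm_star,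
    ← map_sub]
  exact norm_cosetCoeff_le U hU _ _

include hU in
/-- The two sides agree after right multiplication by the essential subspace, because `U γ⁻¹` is
adjoint to `U γ`; the adjoint of their difference lies in that subspace, so they are equal. -/
theorem cosetCoeff_star (γ : Γ) (a : ConvAlg H μH) :
    cosetCoeff U γ⁻¹ (star a) = star (cosetCoeff U γ a) := by
  set w := cosetCoeff U γ a with hw
  set w' := cosetCoeff U γ⁻¹ (star a) with hw'
  have key (y : essential ψ₀) : (w' - star w) * (y : D) = 0 := by
    have h1 := (hU γ).star_mul ⟨ψ₀ (of a), apply_of_mem_essential a⟩ y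
    have h2 := (hU γ⁻¹).mul_left (star a) y
    have h3 := (hU γ⁻¹).mul_right ⟨ψ₀ (of (star a)), apply_of_mem_essential _⟩ y
    rw [sub_mul, sub_eq_zero, hw, cosetCoeff_apply, h1, ← map_star, ← of_star, ← h2]
    exact h3.symm
  have hmem : star (w' - star w) ∈ essential ψ₀ := by
    rw [star_sub, star_star]
    exact sub_mem (star_cosetCoeff_mem_essential U hU _ _) (Subtype.property _)
  have h0 := key ⟨_, hmem⟩
  rw [CStarRing.mul_star_self_eq_zero_iff] at h0
  exact sub_eq_zero.1 h0

variable (hj : IsOpenEmbedding j) (hc : j.range ≤ Subgroup.center Γ)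
  (hH : ∀ h : H, Measure.modularCharacter h = 1)
  (hΓ : ∀ g : Γ, Measure.modularCharacter g = 1)

include hU in
theorem cosetCoeff_mul_map (hUj : ∀ l f, U (j l) ⟨ψ₀ (of f), apply_of_mem_essential f⟩ =
    ⟨ψ₀ (of (translate l f)), apply_of_mem_essential _⟩) (γ : Γ) (l : H) (f : ConvAlg H μH) :
    cosetCoeff U (γ * j l) f = cosetCoeff U γ (translate l f) := by
  rw [cosetCoeff_apply, map_mul, mul_apply_eq_comp, hUj, cosetCoeff_apply]

include hU hc hH hΓ in
/-- The integrated form of a covariant unitary action of a group with open central subgroup `H`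
that extends the action of `H`. -/
theorem exists_integratedForm (μ : Measure Γ) [μ.IsHaarMeasure]
    (hUj : ∀ l f, U (j l) ⟨ψ₀ (of f), apply_of_mem_essential f⟩ =
      ⟨ψ₀ (of (translate l f)), apply_of_mem_essential _⟩) :
    ∃ Ψ : FullGroupCStar Γ μ →⋆ₙₐ[ℂ] D, ∀ γ (f : ConvAlg H μH),
      Ψ (of (translate γ (extend hj f))) = U γ ⟨ψ₀ (of f), apply_of_mem_essential f⟩ := by
  refine ⟨lift (cosetHom hj hc hH hΓ (cosetCoeff U) (cosetCoeff_mul_map U hU hUj)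
    (cosetCoeff_mul U hU) (cosetCoeff_star U hU)) fun F =>
      norm_cosetSum_le hj _ (fun γ f => (norm_cosetCoeff_le U hU γ f).trans (norm_le_L1 f)) F, ?_⟩
  intro γ f
  exact (lift_of _ _ _).trans (cosetSum_translate_extend hj _ (cosetCoeff_mul_map U hU hUj) γ f)

end Integrated

end FullGroupCStar

/-! ### The universal property -/

section Comp

open ConvAlg

variable {H G K : Type*}
  [TopologicalSpace H] [Group H] [IsTopologicalGroup H]
  [MeasurableSpace H] [BorelSpace H]
  [TopologicalSpace G] [Group G] [IsTopologicalGroup G]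
  [MeasurableSpace G] [BorelSpace G]
  [TopologicalSpace K] [Group K] [IsTopologicalGroup K]
  [MeasurableSpace K] [BorelSpace K] {φ : H →* G} {χ : G →* K} {ω : H →* K}
  {μH : Measure H} [μH.IsHaarMeasure] {μG : Measure G} [μG.IsHaarMeasure]
  {μK : Measure K} [μK.IsHaarMeasure]

/-- Successive extension by zero agrees with extension along the composition up to the ratios of
Haar measures; comparing `L¹`-norms then shows that these ratios are multiplicative. -/
theorem ConvAlg.extend_extend_apply (hφ : IsOpenEmbedding φ) (hχ : IsOpenEmbedding χ)
    (hω : IsOpenEmbedding ω) (h : χ.comp φ = ω) (f : ConvAlg H μH) (x : K) :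
    haarRatio hω μH μK * (extend hχ (extend hφ f : ConvAlg G μG) : ConvAlg K μK) x =
      haarRatio hφ μH μG * haarRatio hχ μG μK * (extend hω f : ConvAlg K μK) x := by
  subst h
  by_cases hx : x ∈ χ.range
  · obtain ⟨y, rfl⟩ := hx
    rw [extend_apply_map]
    by_cases hy : y ∈ φ.range
    · obtain ⟨z, rfl⟩ := hy
      rw [extend_apply_map, ← MonoidHom.comp_apply, extend_apply_map]
      ring
    · rw [extend_apply_of_notMem hφ _ hy, extend_apply_of_notMem hω, mul_zero, mul_zero, mul_zero]
      rintro ⟨z, hz⟩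
      exact hy ⟨z, hχ.injective hz⟩
  · rw [extend_apply_of_notMem hχ _ hx, extend_apply_of_notMem hω, mul_zero, mul_zero]
    rintro ⟨z, hz⟩
    exact hx ⟨φ z, hz⟩

theorem ConvAlg.exists_integral_norm_pos [LocallyCompactSpace H] (μH : Measure H)
    [μH.IsHaarMeasure] : ∃ f : ConvAlg H μH, 0 < ∫ y, ‖f y‖ ∂μH := by
  obtain ⟨⟨u, u_cont⟩, u_comp, u_nonneg, u_one⟩ :
    ∃ u : C(H, ℝ), HasCompactSupport u ∧ 0 ≤ u ∧ u 1 ≠ 0 := exists_continuous_nonneg_pos 1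
  let f : C_c(H, ℂ) := ⟨⟨fun x => (u x : ℂ), Complex.continuous_ofReal.comp u_cont⟩,
    u_comp.comp_left (g := fun x : ℝ => (x : ℂ)) Complex.ofReal_zero⟩
  refine ⟨f, ?_⟩
  have h : ∀ y, ‖(f : ConvAlg H μH) y‖ = u y := fun y =>
    (Complex.norm_real _).trans (Real.norm_of_nonneg (u_nonneg y))
  exact (u_cont.integral_pos_of_hasCompactSupport_nonneg_nonzero u_comp u_nonneg u_one).trans_eq
    (integral_congr_ae (.of_forall fun y => (h y).symm))

theorem haarRatio_comp [LocallyCompactSpace H] (hφ : IsOpenEmbedding φ) (hχ : IsOpenEmbedding χ)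
    (hω : IsOpenEmbedding ω) (h : χ.comp φ = ω) (μH : Measure H) [μH.IsHaarMeasure]
    (μG : Measure G) [μG.IsHaarMeasure] (μK : Measure K) [μK.IsHaarMeasure] :
    haarRatio hω μH μK = haarRatio hφ μH μG * haarRatio hχ μG μK := by
  obtain ⟨f, hf⟩ := exists_integral_norm_pos μH
  have e1 := integral_norm_extend (μG := μK) hχ (extend hφ f : ConvAlg G μG)
  rw [integral_norm_extend hφ, ← integral_norm_extend (μG := μK) hω] at e1
  have hf' := hf
  rw [← integral_norm_extend (μG := μK) hω] at hf'
  have e2 (x : K) : haarRatio hω μH μK *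
        ‖(extend hχ (extend hφ f : ConvAlg G μG) : ConvAlg K μK) x‖ =
      haarRatio hφ μH μG * haarRatio hχ μG μK * ‖(extend hω f : ConvAlg K μK) x‖ := by
    have := congrArg norm (extend_extend_apply (μG := μG) (μK := μK) hφ hχ hω h f x)
    simpa only [norm_mul, Complex.norm_real, Real.norm_of_nonneg (haarRatio_pos _ _ _).le]
      using this
  have e3 := congrArg (fun F : K → ℝ => ∫ x, F x ∂μK) (funext e2)
  simp only [integral_const_mul, e1] at e3
  exact mul_right_cancel₀ hf'.ne' e3

theorem ConvAlg.extend_extend [LocallyCompactSpace H] (hφ : IsOpenEmbedding φ)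
    (hχ : IsOpenEmbedding χ) (hω : IsOpenEmbedding ω) (h : χ.comp φ = ω) (f : ConvAlg H μH) :
    (extend hχ (extend hφ f : ConvAlg G μG) : ConvAlg K μK) = extend hω f := by
  apply ext; intro x
  have e := extend_extend_apply (μG := μG) (μK := μK) hφ hχ hω h f x
  rw [← Complex.ofReal_mul, ← haarRatio_comp hφ hχ hω h] at e
  exact mul_left_cancel₀ (haarRatio_ne_zero hω) e

end Comp

namespace FullGroupCStar

open ConvAlg

section Translate

variable {H G : Type*}
  [TopologicalSpace H] [Group H] [IsTopologicalGroup H] [LocallyCompactSpace H]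
  [MeasurableSpace H] [BorelSpace H]
  [TopologicalSpace G] [Group G] [IsTopologicalGroup G] [LocallyCompactSpace G]
  [MeasurableSpace G] [BorelSpace G] {φ : H →* G}
  {μH : Measure H} [μH.IsHaarMeasure] {μG : Measure G} [μG.IsHaarMeasure]
  (hφ : IsOpenEmbedding φ) (hc : φ.range ≤ Subgroup.center G)
  (hH : ∀ h : H, Measure.modularCharacter h = 1) (hG : ∀ g : G, Measure.modularCharacter g = 1)

include hc hH hG in
theorem norm_translate_extend_le (g : G) (f : ConvAlg H μH) :
    ‖(translate g (extend hφ f) : ConvAlg G μG)‖ ≤ ‖f‖ := by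
  rw [← norm_of]
  exact norm_translateCoeff_le hφ hc hH hG _ (NonUnitalStarAlgHom.id ℂ (FullGroupCStar G μG)) rfl
    g f

include hc hH hG in
/-- The elements `g` for which a closed subalgebra of `C*(G)` contains all functions supported on
the coset of `g` are closed under multiplication. -/
theorem of_translate_mul_mem (S : NonUnitalSubalgebra ℂ (FullGroupCStar G μG))
    (hS : IsClosed (S : Set (FullGroupCStar G μG))) {g h : G}
    (hg : ∀ f : ConvAlg H μH, of (translate g (extend hφ f)) ∈ S)
    (hh : ∀ f : ConvAlg H μH, of (translate h (extend hφ f)) ∈ S) (f : ConvAlg H μH) :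
    of (translate (g * h) (extend hφ f) : ConvAlg G μG) ∈ S := by
  refine hS.closure_subset (Metric.mem_closure_iff.2 fun ε hε => ?_)
  obtain ⟨e, he⟩ := exists_norm_mul_sub_lt f hε
  refine ⟨of (translate (g * h) (extend hφ (e * f))), ?_, ?_⟩
  · rw [← translate_extend_mul hφ hc, of_mul]
    exact mul_mem (hg e) (hh f)
  · rw [dist_comm, dist_eq_norm, ← of_sub, ← map_sub, ← map_sub, norm_of]
    exact (norm_translate_extend_le hφ hc hH hG _ _).trans_lt he

end Translate

end FullGroupCStar

open FullGroupCStar ConvAlg in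
/-- The full C*-algebra of the amalgamated free product over a central open subgroup has the
universal property of the amalgamated free product of C*-algebras. -/
theorem isAmalgFreeProduct_induced {Λ : Type u₀} {G₁ : Type u₁} {G₂ : Type u₂}
    [Group Λ] [TopologicalSpace Λ] [IsTopologicalGroup Λ] [LocallyCompactSpace Λ]
    [MeasurableSpace Λ] [BorelSpace Λ]
    [Group G₁] [TopologicalSpace G₁] [IsTopologicalGroup G₁] [LocallyCompactSpace G₁]
    [MeasurableSpace G₁] [BorelSpace G₁]
    [Group G₂] [TopologicalSpace G₂] [IsTopologicalGroup G₂] [LocallyCompactSpace G₂]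
    [MeasurableSpace G₂] [BorelSpace G₂]
    {φ₁ : Λ →* G₁} {φ₂ : Λ →* G₂}
    [LocallyCompactSpace (AmalgProd φ₁ φ₂)]
    [MeasurableSpace (AmalgProd φ₁ φ₂)] [BorelSpace (AmalgProd φ₁ φ₂)]
    (ν : Measure Λ) [ν.IsHaarMeasure] (μ₁ : Measure G₁) [μ₁.IsHaarMeasure]
    (μ₂ : Measure G₂) [μ₂.IsHaarMeasure]
    (μ : Measure (AmalgProd φ₁ φ₂)) [μ.IsHaarMeasure]
    (hφ₁ : IsOpenEmbedding φ₁) (hφ₂ : IsOpenEmbedding φ₂)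
    (hc₁ : φ₁.range ≤ Subgroup.center G₁) (hc₂ : φ₂.range ≤ Subgroup.center G₂)
    (hi₁ : IsOpenEmbedding (AmalgProd.inl φ₁ φ₂)) (hi₂ : IsOpenEmbedding (AmalgProd.inr φ₁ φ₂))
    (hΛ : ∀ l : Λ, Measure.modularCharacter l = 1)
    (h₁ : ∀ g : G₁, Measure.modularCharacter g = 1)
    (h₂ : ∀ g : G₂, Measure.modularCharacter g = 1)
    (hΓ : ∀ g : AmalgProd φ₁ φ₂, Measure.modularCharacter g = 1) :
    IsAmalgFreeProduct.{w}
      (induced hφ₁ hΛ h₁ : FullGroupCStar Λ ν →⋆ₙₐ[ℂ] FullGroupCStar G₁ μ₁)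
      (induced hφ₂ hΛ h₂ : FullGroupCStar Λ ν →⋆ₙₐ[ℂ] FullGroupCStar G₂ μ₂)
      (induced hi₁ h₁ hΓ : _ →⋆ₙₐ[ℂ] FullGroupCStar (AmalgProd φ₁ φ₂) μ)
      (induced hi₂ h₂ hΓ) := by
  set j : Λ →* AmalgProd φ₁ φ₂ := (AmalgProd.inl φ₁ φ₂).comp φ₁ with hj_def
  have hj_def' : (AmalgProd.inr φ₁ φ₂).comp φ₂ = j := (AmalgProd.inl_comp_eq φ₁ φ₂).symm
  have hj : IsOpenEmbedding j := hi₁.comp hφ₁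
  have hc : j.range ≤ Subgroup.center (AmalgProd φ₁ φ₂) := AmalgProd.range_le_center hc₁ hc₂
  -- The canonical maps carry functions on a coset of `Λ` to functions on a coset of `Λ`.
  have hι₁ (g : G₁) (f : ConvAlg Λ ν) :
      (induced hi₁ h₁ hΓ (of (translate g (extend hφ₁ f) : ConvAlg G₁ μ₁)) :
        FullGroupCStar (AmalgProd φ₁ φ₂) μ) =
      of (translate (AmalgProd.inl φ₁ φ₂ g) (extend hj f)) := by
    rw [induced_of, extend_translate, extend_extend hφ₁ hi₁ hj hj_def.symm]
  have hι₂ (g : G₂) (f : ConvAlg Λ ν) :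
      (induced hi₂ h₂ hΓ (of (translate g (extend hφ₂ f) : ConvAlg G₂ μ₂)) :
        FullGroupCStar (AmalgProd φ₁ φ₂) μ) =
      of (translate (AmalgProd.inr φ₁ φ₂ g) (extend hj f)) := by
    rw [induced_of, extend_translate, extend_extend hφ₂ hi₂ hj hj_def']
  -- A closed subalgebra that contains the images of both canonical maps is everything.
  have hgen (S : NonUnitalSubalgebra ℂ (FullGroupCStar (AmalgProd φ₁ φ₂) μ))
      (hS : IsClosed (S : Set (FullGroupCStar (AmalgProd φ₁ φ₂) μ)))
      (hS₁ : ∀ a : FullGroupCStar G₁ μ₁, induced hi₁ h₁ hΓ a ∈ S)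
      (hS₂ : ∀ a : FullGroupCStar G₂ μ₂, induced hi₂ h₂ hΓ a ∈ S) :
      ∀ a, a ∈ S := by
    have hT (γ : AmalgProd φ₁ φ₂) :
        ∀ f : ConvAlg Λ ν, of (translate γ (extend hj f) : ConvAlg (AmalgProd φ₁ φ₂) μ) ∈ S := by
      induction γ using AmalgProd.induction with
      | hl g => intro f; rw [← hι₁]; exact hS₁ _
      | hr g => intro f; rw [← hι₂]; exact hS₂ _
      | hmul x y hx hy => exact of_translate_mul_mem hj hc hΛ hΓ S hS hx hy
    intro a
    induction a using induction_on with
    | hP => exact hS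
    | h F =>
      induction F using induction_translate_extend (μH := ν) (μG := μ) hj with
      | zero => rw [of_zero]; exact zero_mem S
      | add F K hF hK => rw [of_add]; exact add_mem hF hK
      | translate_extend γ f => exact hT γ f
  refine ⟨injective_induced hφ₁ hc₁ hΛ h₁, injective_induced hφ₂ hc₂ hΛ h₂, ?_, ?_, ?_⟩
  · refine hom_ext fun f => ?_
    rw [NonUnitalStarAlgHom.comp_apply, NonUnitalStarAlgHom.comp_apply, induced_of, induced_of,
      induced_of, induced_of, extend_extend hφ₁ hi₁ hj hj_def.symm,
      extend_extend hφ₂ hi₂ hj hj_def']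
  · set R := NonUnitalStarAlgebra.adjoin ℂ
      (Set.range (induced hi₁ h₁ hΓ : FullGroupCStar G₁ μ₁ →⋆ₙₐ[ℂ]
        FullGroupCStar (AmalgProd φ₁ φ₂) μ) ∪
      Set.range (induced hi₂ h₂ hΓ : FullGroupCStar G₂ μ₂ →⋆ₙₐ[ℂ]
        FullGroupCStar (AmalgProd φ₁ φ₂) μ)) with hR
    refine hgen R.toNonUnitalSubalgebra.topologicalClosure
      (NonUnitalSubalgebra.isClosed_topologicalClosure _) (fun a => ?_) fun a => ?_
    · exact NonUnitalSubalgebra.le_topologicalClosure _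
        (NonUnitalStarAlgebra.subset_adjoin ℂ _ (Or.inl ⟨a, rfl⟩))
    · exact NonUnitalSubalgebra.le_topologicalClosure _
        (NonUnitalStarAlgebra.subset_adjoin ℂ _ (Or.inr ⟨a, rfl⟩))
  · intro D _ ψ₁ ψ₂ hψ
    obtain ⟨ψ₀, hψ₀⟩ : ∃ ψ₀ : FullGroupCStar Λ ν →⋆ₙₐ[ℂ] D,
      ψ₁.comp (induced hφ₁ hΛ h₁) = ψ₀ := ⟨_, rfl⟩
    have hψ₀' : ψ₂.comp (induced hφ₂ hΛ h₂) = ψ₀ := hψ.symm.trans hψ₀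
    -- The actions of the two factors agree on `Λ`, and so define an action of the free product.
    let U₁ := actionHom hφ₁ hc₁ hΛ h₁ ψ₀ ψ₁ hψ₀
    let U₂ := actionHom hφ₂ hc₂ hΛ h₂ ψ₀ ψ₂ hψ₀'
    have hU : U₁.toHomUnits.comp φ₁ = U₂.toHomUnits.comp φ₂ := by
      ext1 l
      ext1
      change action hφ₁ hc₁ hΛ h₁ ψ₀ ψ₁ hψ₀ (φ₁ l) = action hφ₂ hc₂ hΛ h₂ ψ₀ ψ₂ hψ₀' (φ₂ l)
      ext1 y
      refine essential_ext fun e => ?_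
      rw [mul_action_map, mul_action_map]
    let U : AmalgProd φ₁ φ₂ →* (essential ψ₀ →L[ℂ] essential ψ₀) :=
      (Units.coeHom _).comp (AmalgProd.lift U₁.toHomUnits U₂.toHomUnits hU)
    have hUl (g : G₁) : U (AmalgProd.inl φ₁ φ₂ g) = action hφ₁ hc₁ hΛ h₁ ψ₀ ψ₁ hψ₀ g := by
      change ((AmalgProd.lift _ _ hU _ : (_)ˣ) : essential ψ₀ →L[ℂ] essential ψ₀) = _
      rw [AmalgProd.lift_inl]; rfl
    have hUr (g : G₂) : U (AmalgProd.inr φ₁ φ₂ g) = action hφ₂ hc₂ hΛ h₂ ψ₀ ψ₂ hψ₀' g := by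
      change ((AmalgProd.lift _ _ hU _ : (_)ˣ) : essential ψ₀ →L[ℂ] essential ψ₀) = _
      rw [AmalgProd.lift_inr]; rfl
    have hcov (γ : AmalgProd φ₁ φ₂) : IsCovariant ψ₀ U γ := by
      induction γ using AmalgProd.induction with
      | hl g =>
        have h := isCovariant_action hφ₁ hc₁ hΛ h₁ ψ₀ ψ₁ hψ₀ g
        refine ⟨?_, ?_, ?_⟩
        · rw [← map_inv, hUl, hUl]; exact h.star_mul
        · rw [hUl]; exact h.mul_right
        · rw [hUl]; exact h.mul_left
      | hr g =>
        have h := isCovariant_action hφ₂ hc₂ hΛ h₂ ψ₀ ψ₂ hψ₀' g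
        refine ⟨?_, ?_, ?_⟩
        · rw [← map_inv, hUr, hUr]; exact h.star_mul
        · rw [hUr]; exact h.mul_right
        · rw [hUr]; exact h.mul_left
      | hmul x y hx hy => exact hx.mul hy
    obtain ⟨Ψ, hΨ⟩ := exists_integratedForm U hcov hj hc hΛ hΓ μ fun l f =>
      (DFunLike.congr_fun (hUl (φ₁ l)) _).trans (action_map_apply_of hφ₁ hc₁ hΛ h₁ ψ₀ ψ₁ hψ₀ l f)
    have hΨ₁ : Ψ.comp (induced hi₁ h₁ hΓ) = ψ₁ := hom_ext fun F => by
      rw [NonUnitalStarAlgHom.comp_apply]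
      induction F using induction_translate_extend (μH := ν) (μG := μ₁) hφ₁ with
      | zero => rw [of_zero, map_zero, map_zero, map_zero]
      | add F K hF hK => rw [of_add, map_add, map_add, map_add, hF, hK]
      | translate_extend g f => rw [hι₁, hΨ, hUl, coe_action_apply_of]; rfl
    have hΨ₂ : Ψ.comp (induced hi₂ h₂ hΓ) = ψ₂ := hom_ext fun F => by
      rw [NonUnitalStarAlgHom.comp_apply]
      induction F using induction_translate_extend (μH := ν) (μG := μ₂) hφ₂ with
      | zero => rw [of_zero, map_zero, map_zero, map_zero]
      | add F K hF hK => rw [of_add, map_add, map_add, map_add, hF, hK]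
      | translate_extend g f => rw [hι₂, hΨ, hUr, coe_action_apply_of]; rfl
    refine ⟨Ψ, ⟨hΨ₁, hΨ₂⟩, ?_⟩
    rintro Ψ' ⟨hΨ₁', hΨ₂'⟩
    refine DFunLike.ext _ _ fun a => hgen (NonUnitalAlgHom.equalizer Ψ' Ψ)
      (isClosed_eq (continuous_hom Ψ') (continuous_hom Ψ)) (fun a => ?_) (fun a => ?_) a
    · exact DFunLike.congr_fun (hΨ₁'.trans hΨ₁.symm) a
    · exact DFunLike.congr_fun (hΨ₂'.trans hΨ₂.symm) a

theorem mainTheorem4 {Λ : Type u₀} {G₁ : Type u₁} {G₂ : Type u₂}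
    [Group Λ] [TopologicalSpace Λ] [IsTopologicalGroup Λ] [LocallyCompactSpace Λ] [T2Space Λ]
    [MeasurableSpace Λ] [BorelSpace Λ]
    [Group G₁] [TopologicalSpace G₁] [IsTopologicalGroup G₁] [LocallyCompactSpace G₁] [T2Space G₁]
    [MeasurableSpace G₁] [BorelSpace G₁]
    [Group G₂] [TopologicalSpace G₂] [IsTopologicalGroup G₂] [LocallyCompactSpace G₂] [T2Space G₂]
    [MeasurableSpace G₂] [BorelSpace G₂]
    (φ₁ : Λ →* G₁) (φ₂ : Λ →* G₂)
    (hφ₁ : Topology.IsOpenEmbedding φ₁) (hφ₂ : Topology.IsOpenEmbedding φ₂)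
    (hc₁ : φ₁.range ≤ Subgroup.center G₁) (hc₂ : φ₂.range ≤ Subgroup.center G₂) :
    T2Space (AmalgProd φ₁ φ₂) ∧
    Topology.IsOpenEmbedding (AmalgProd.inl φ₁ φ₂) ∧
    Topology.IsOpenEmbedding (AmalgProd.inr φ₁ φ₂) ∧
    ∃ _ : LocallyCompactSpace (AmalgProd φ₁ φ₂),
      ∀ [MeasurableSpace (AmalgProd φ₁ φ₂)] [BorelSpace (AmalgProd φ₁ φ₂)]
        (ν : Measure Λ) [ν.IsHaarMeasure] (μ₁ : Measure G₁) [μ₁.IsHaarMeasure]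
        (μ₂ : Measure G₂) [μ₂.IsHaarMeasure]
        (μ : Measure (AmalgProd φ₁ φ₂)) [μ.IsHaarMeasure],
      ∃ (j₁ : FullGroupCStar Λ ν →⋆ₙₐ[ℂ] FullGroupCStar G₁ μ₁)
        (j₂ : FullGroupCStar Λ ν →⋆ₙₐ[ℂ] FullGroupCStar G₂ μ₂)
        (ι₁ : FullGroupCStar G₁ μ₁ →⋆ₙₐ[ℂ] FullGroupCStar (AmalgProd φ₁ φ₂) μ)
        (ι₂ : FullGroupCStar G₂ μ₂ →⋆ₙₐ[ℂ] FullGroupCStar (AmalgProd φ₁ φ₂) μ),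
        IsInducedHom φ₁ ν μ₁ j₁ ∧ IsInducedHom φ₂ ν μ₂ j₂ ∧
        IsInducedHom (AmalgProd.inl φ₁ φ₂) μ₁ μ ι₁ ∧
        IsInducedHom (AmalgProd.inr φ₁ φ₂) μ₂ μ ι₂ ∧
        IsAmalgFreeProduct.{w} j₁ j₂ ι₁ ι₂ := by
  have hi₁ := AmalgProd.isOpenEmbedding_inl hφ₁ hφ₂ hc₁ hc₂
  have hi₂ := AmalgProd.isOpenEmbedding_inr hφ₁ hφ₂ hc₁ hc₂
  refine ⟨MonoidHom.t2Space_of_isOpenEmbedding hi₁, hi₁, hi₂,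
    MonoidHom.locallyCompactSpace_of_isOpenEmbedding hi₁, ?_⟩
  have := MonoidHom.locallyCompactSpace_of_isOpenEmbedding hi₁
  intro _ _ ν _ μ₁ _ μ₂ _ μ _
  have hΛ : ∀ l : Λ, Measure.modularCharacter l = 1 := by
    refine modularCharacter_eq_one_of_central (φ := MonoidHom.id Λ) .id ?_
    rintro l -
    refine Subgroup.mem_center_iff.2 fun m => hφ₁.injective ?_
    rw [map_mul, map_mul, Subgroup.mem_center_iff.1 (hc₁ ⟨l, rfl⟩)]
  have h₁ := modularCharacter_eq_one_of_central hφ₁ hc₁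
  have h₂ := modularCharacter_eq_one_of_central hφ₂ hc₂
  have hΓ := modularCharacter_eq_one_of_central (φ := (AmalgProd.inl φ₁ φ₂).comp φ₁)
    (hi₁.comp hφ₁) (AmalgProd.range_le_center hc₁ hc₂)
  exact ⟨FullGroupCStar.induced hφ₁ hΛ h₁, FullGroupCStar.induced hφ₂ hΛ h₂,
    FullGroupCStar.induced hi₁ h₁ hΓ, FullGroupCStar.induced hi₂ h₂ hΓ,
    FullGroupCStar.isInducedHom_induced hφ₁ hΛ h₁, FullGroupCStar.isInducedHom_induced hφ₂ hΛ h₂,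
    FullGroupCStar.isInducedHom_induced hi₁ h₁ hΓ, FullGroupCStar.isInducedHom_induced hi₂ h₂ hΓ,
    isAmalgFreeProduct_induced ν μ₁ μ₂ μ hφ₁ hφ₂ hc₁ hc₂ hi₁ hi₂ hΛ h₁ h₂ hΓ⟩
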